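/- Setting. For each $n$, an undirected network $G=G^{(n)}$ without self-links on the players $1,\dots,n$ is observed, with adjacency matrix $(G_{ij})$. Player $i$ has an observed attribute $X_i$ and an unobserved degree-heterogeneity term $A_{i0}\in\mathbb R$; for a known measurable map $w$ put $X_{ij}=w(X_i,X_j)\in\mathbb R^{\dim\beta}$. Let $J_n\subset\{1,\dots,n\}$ be sets of players whose cardinalities are bounded uniformly in $n$, and let $\theta=(\beta,\delta)$ with $\beta\in\mathbb A\subset\mathbb R^{\dim\beta}$, $\delta\in\mathbb B\subset\mathbb R$. For $\mathbf A=(A_1,\dots,A_n)$ and $i<j$ let $$p_{ij}(\theta,\mathbf A)=\frac{\exp\big((\sum_{k\in J_n}G_{ik}G_{jk})\delta+X_{ij}'\beta+A_i+A_j\big)}{1+\exp\big((\sum_{k\in J_n}G_{ik}G_{jk})\delta+X_{ij}'\beta+A_i+A_j\big)},$$ $$L_n(\theta,\mathbf A)=\sum_{i<j}\big\{G_{ij}\ln p_{ij}(\theta,\mathbf A)+(1-G_{ij})\ln[1-p_{ij}(\theta,\mathbf A)]\big\}.$$ Let $\theta_0=(\beta_0,\delta_0)$ be the true parameter and $\mathbf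 A_{n0}=(A_{10},\dots,A_{n0})$. Assumptions. 1. (Likelihood) For each $n$, conditionally on $\mathbf X=(X_1,\dots,X_n)$ and $\mathbf A_{n0}$, the network equals $\mathbf g$ with probability $\prod_{i<j}p_{ij}^{g_{ij}}(1-p_{ij})^{1-g_{ij}}$, where $p_{ij}=p_{ij}(\theta_0,\mathbf A_{n0})$ is evaluated at $G=\mathbf g$. 2. (Joint identification) The $A_{i0}$ take values almost surely in a compact set $\mathbb I\subset\mathbb R$ and, almost surely, for all large enough $n$ the conditional expectation $\mathbb E[L_n(\theta,\mathbf A)\mid\mathbf X,\mathbf A_{n0}]$ (taken over $G$ under the law in 1), as a function of $(\theta,\mathbf A)\in(\mathbb A\times\mathbb B)\times\mathbb I^n$, is uniquely maximized at $(\theta_0,\mathbf A_{n0})$. 3. (i) (Regularity) $\mathbb A\times\mathbb B$ is compact, $(\beta_0,\delta_0)\in\operatorname{int}(\mathbb A)\times\operatorname{int}(\mathbb B)$, and for $i\ne j$ the covariate $X_{ij}$ takes values almost surely in a compact set $\mathbb X\subset\mathbb R^{\dim\beta}$. (ii) (Random sampling) The pairs $(X_i,A_{i0})$, $i=1,2,\dots$,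 are independent and identically distributed. Conclusion. Let $(\tilde\theta_{JML},\tilde{\mathbf A}_n)$ be a joint maximum likelihood estimator, that is, a maximizer of $L_n(\theta,\mathbf A)$ over $(\theta,\mathbf A)\in(\mathbb A\times\mathbb B)\times\mathbb I^n$. Then $\tilde\theta_{JML}\to\theta_0$ in probability as $n\to\infty$. -/

import Mathlib

open MeasureTheory ProbabilityTheory Filter Topology

open scoped Classical in
/-- The binary link indicator `G i j ∈ {0, 1}` of an undirected network without self-links. -/
noncomputable def link {n : ℕ} (g : SimpleGraph (Fin n)) (i j : Fin n) : ℕ :=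
  if g.Adj i j then 1 else 0

/-- The interdependence term `∑ k ∈ J, G i k * G j k`: the number of players of `J` to whom
both `i` and `j` are linked. -/
noncomputable def commonLinks {n : ℕ} (J : Finset (Fin n)) (g : SimpleGraph (Fin n))
    (i j : Fin n) : ℕ :=
  ∑ k ∈ J, link g i k * link g j k

/-- The systematic part of the link surplus,
`(∑ k ∈ J, G i k * G j k) * δ + X i j ⬝ β + A i + A j`, with `θ = (β, δ)`. -/
noncomputable def surplus {n K : ℕ} (J : Finset (Fin n))
    (x : Fin n → Fin n → EuclideanSpace ℝ (Fin K)) (θ : EuclideanSpace ℝ (Fin K) × ℝ)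
    (a : Fin n → ℝ) (g : SimpleGraph (Fin n)) (i j : Fin n) : ℝ :=
  (commonLinks J g i j : ℝ) * θ.2 + inner ℝ (x i j) θ.1 + (a i + a j)

/-- The logit link probability `p i j (θ, A)`. -/
noncomputable def linkProb {n K : ℕ} (J : Finset (Fin n))
    (x : Fin n → Fin n → EuclideanSpace ℝ (Fin K)) (θ : EuclideanSpace ℝ (Fin K) × ℝ)
    (a : Fin n → ℝ) (g : SimpleGraph (Fin n)) (i j : Fin n) : ℝ :=
  Real.exp (surplus J x θ a g i j) / (1 + Real.exp (surplus J x θ a g i j))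

/-- The likelihood of the network `g`: the product over the dyads `i < j` of
`(1 - p i j) ^ (1 - g i j) * p i j ^ (g i j)`. -/
noncomputable def likelihood {n K : ℕ} (J : Finset (Fin n))
    (x : Fin n → Fin n → EuclideanSpace ℝ (Fin K)) (θ : EuclideanSpace ℝ (Fin K) × ℝ)
    (a : Fin n → ℝ) (g : SimpleGraph (Fin n)) : ℝ :=
  ∏ i : Fin n, ∏ j ∈ Finset.Ioi i,
    (1 - linkProb J x θ a g i j) ^ (1 - link g i j) * linkProb J x θ a g i j ^ link g i j

/-- The log-likelihood `L n (θ, A)` of the observed network `g`. -/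
noncomputable def logLik {n K : ℕ} (J : Finset (Fin n))
    (x : Fin n → Fin n → EuclideanSpace ℝ (Fin K)) (g : SimpleGraph (Fin n))
    (θ : EuclideanSpace ℝ (Fin K) × ℝ) (a : Fin n → ℝ) : ℝ :=
  ∑ i : Fin n, ∑ j ∈ Finset.Ioi i,
    ((link g i j : ℝ) * Real.log (linkProb J x θ a g i j) +
      (1 - (link g i j : ℝ)) * Real.log (1 - linkProb J x θ a g i j))

open scoped Classical in
/-- The population criterion `E[L n (θ, A) | X, A₀]`: the log-likelihood at `(θ, A)` averaged over
the networks, weighted by their conditional probabilities given the covariates and the true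
heterogeneity terms `a₀` under the true parameter `θ₀`. -/
noncomputable def popCriterion {n K : ℕ} (J : Finset (Fin n))
    (x : Fin n → Fin n → EuclideanSpace ℝ (Fin K)) (θ₀ : EuclideanSpace ℝ (Fin K) × ℝ)
    (a₀ : Fin n → ℝ) (θ : EuclideanSpace ℝ (Fin K) × ℝ) (a : Fin n → ℝ) : ℝ :=
  ∑ g : SimpleGraph (Fin n), likelihood J x θ₀ a₀ g * logLik J x g θ a

/-- `(θ, a)` is a joint maximum likelihood estimate: it maximizes the log-likelihood
over the parameter space `Θ × 𝕀ⁿ`. -/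
def IsJML {n K : ℕ} (J : Finset (Fin n)) (x : Fin n → Fin n → EuclideanSpace ℝ (Fin K))
    (g : SimpleGraph (Fin n)) (Θ : Set (EuclideanSpace ℝ (Fin K) × ℝ)) (I : Set ℝ)
    (θ : EuclideanSpace ℝ (Fin K) × ℝ) (a : Fin n → ℝ) : Prop :=
  θ ∈ Θ ∧ (∀ i, a i ∈ I) ∧
    ∀ θ' ∈ Θ, ∀ a' : Fin n → ℝ, (∀ i, a' i ∈ I) → logLik J x g θ' a' ≤ logLik J x g θ a

/-- The population criterion has its unique maximum over `Θ × 𝕀ⁿ` at the truth `(θ₀, a₀)`. -/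
def IsJointlyIdentified {n K : ℕ} (J : Finset (Fin n))
    (x : Fin n → Fin n → EuclideanSpace ℝ (Fin K)) (Θ : Set (EuclideanSpace ℝ (Fin K) × ℝ))
    (I : Set ℝ) (θ₀ : EuclideanSpace ℝ (Fin K) × ℝ) (a₀ : Fin n → ℝ) : Prop :=
  ∀ θ ∈ Θ, ∀ a : Fin n → ℝ, (∀ i, a i ∈ I) → (θ, a) ≠ (θ₀, a₀) →
    popCriterion J x θ₀ a₀ θ a < popCriterion J x θ₀ a₀ θ₀ a₀

/-- The dyadic covariates `X i j = w (X i, X j)` of the first `n` players. -/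
def dyadCov {𝒳 : Type*} {K : ℕ} (w : 𝒳 → 𝒳 → EuclideanSpace ℝ (Fin K)) (ξ : ℕ → 𝒳) (n : ℕ)
    (i j : Fin n) : EuclideanSpace ℝ (Fin K) :=
  w (ξ i) (ξ j)

/-- The sigma-algebra generated by the attributes and heterogeneity terms `(X i, A i)` of the
first `n` players. -/
@[reducible] def playerSigma {Ω 𝒳 : Type*} [MeasurableSpace 𝒳] (X : ℕ → Ω → 𝒳) (A : ℕ → Ω → ℝ) (n : ℕ) :
    MeasurableSpace Ω :=
  MeasurableSpace.comap (fun ω (i : Fin n) => (X i ω, A i ω)) inferInstance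

/-!
Consistency of the joint maximum likelihood estimator in a logit network model with links in common
with a bounded reference set `J`.

The log-likelihood is concave in the surpluses, so the difference of its values at the truth and at
`(θ, a)` is the sum over the dyads of the divergences `klLogit` minus a term linear in the residuals
`G i j - p i j` (`logLik_sub_logLik`). At a maximum likelihood estimate the sum of the divergences
is therefore at most the linear term, and consistency follows from two facts.

*The linear term is `o(n ^ 2)`, uniformly in the parameter.* It is linear in the parameter
differences, so a supremum over the growing parameter space reduces to finitely many residual sums
for each player. Common links only involve links with `J`, hence switching a link between two
players outside `J` changes a single factor of the likelihood, and pairing each network with the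
switched one shows that the residuals of dyads outside `J` are uncorrelated
(`sum_likelihood_mul_linkResid_mul`). The residual sums have expectation `O(n ^ (3 / 2))`
(`sum_likelihood_mul_scoreNorm_le`); there are only `O(n)` dyads that meet `J`.

*The divergences sum to at least a multiple of `n ^ 2` when `θ` is far from `θ₀`.* Identification in
each finite sample is turned into a uniform statement by looking at tuples of fixed size. For large
`N`, a tuple of `N + 2` players of which only the last two have a common link with `J` has
with high probability a divergence bounded below on the compact set of distant parameters: a zero
divergence would contradict identification among the first `N` players for `β`, and a four-cycle in
which the heterogeneity terms cancel gives `δ` (`tupleGap_pos`, `exists_measure_playerGap_lt_le`).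
Whatever the other links with `J`, the prescribed pattern of links with `J` has probability bounded
below; this is shown by summing out the links outside `J` and switching links with `J` one at a
time (`sum_likelihood_mul_prod_le`). Among sufficiently many disjoint tuples, one has therefore both
properties with probability close to one, and by exchangeability this holds for every choice of
the players. Applying this to the arithmetic progressions of players, of which there are of order
`n ^ 2` and no two of which have the same pair of players in two given positions, Markov's
inequality gives the lower bound (`gap_le_of_isJML`, `measureReal_dist_jml_le`).
-/

/-! ### Logit divergences, dyads and switching links -/

/-- The Kullback–Leibler divergence between the Bernoulli laws with log-odds `s₀` and `s`. -/
noncomputable def klLogit (s₀ s : ℝ) : ℝ :=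
  Real.log (1 + Real.exp s) - Real.log (1 + Real.exp s₀) -
    Real.exp s₀ / (1 + Real.exp s₀) * (s - s₀)

theorem klLogit_self (s : ℝ) : klLogit s s = 0 := by simp [klLogit]

theorem klLogit_pos {s₀ s : ℝ} (h : s ≠ s₀) : 0 < klLogit s₀ s := by
  have h0 : 0 < 1 + Real.exp s₀ := by positivity
  have h1 : 0 < 1 + Real.exp s := by positivity
  set p := Real.exp s₀ / (1 + Real.exp s₀) with hp
  have hp0 : 0 < p := by positivity
  have hp1 : 0 < 1 - p := by
    rw [hp, sub_pos, div_lt_one h0]; linarith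
  have key := strictConvexOn_exp.2 (Set.mem_univ (0 : ℝ)) (Set.mem_univ (s - s₀))
    (fun h' => h (by linarith)) hp1 hp0 (by ring)
  simp only [smul_eq_mul, mul_zero, zero_add, Real.exp_zero, mul_one] at key
  have hmean : (1 - p) + p * Real.exp (s - s₀) = (1 + Real.exp s) / (1 + Real.exp s₀) := by
    rw [Real.exp_sub, hp]
    field_simp
    ring
  rw [hmean] at key
  have := Real.log_lt_log (Real.exp_pos _) key
  rw [Real.log_exp, Real.log_div h1.ne' h0.ne'] at this
  unfold klLogit
  linarith

theorem klLogit_nonneg (s₀ s : ℝ) : 0 ≤ klLogit s₀ s := by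
  by_cases h : s = s₀
  · rw [h, klLogit_self]
  · exact (klLogit_pos h).le

theorem eq_of_klLogit_eq_zero {s₀ s : ℝ} (h : klLogit s₀ s = 0) : s = s₀ := by
  by_contra hne
  exact (klLogit_pos hne).ne' h

theorem continuous_klLogit : Continuous fun p : ℝ × ℝ => klLogit p.1 p.2 := by
  unfold klLogit
  have h : ∀ s : ℝ, 1 + Real.exp s ≠ 0 := fun s => by positivity
  fun_prop (disch := intro x; exact h _)

/-- The dyads of an `n`-player network, as ordered pairs `i < j`. -/
def dyads (n : ℕ) : Finset (Fin n × Fin n) := Finset.univ.filter fun e => e.1 < e.2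

theorem mem_dyads {n : ℕ} {e : Fin n × Fin n} : e ∈ dyads n ↔ e.1 < e.2 := by simp [dyads]

theorem sum_Ioi_eq_sum_dyads {n : ℕ} (f : Fin n → Fin n → ℝ) :
    ∑ i : Fin n, ∑ j ∈ Finset.Ioi i, f i j = ∑ e ∈ dyads n, f e.1 e.2 :=
  (Finset.sum_finset_product (dyads n) Finset.univ Finset.Ioi (by simp [dyads])
    (f := fun e => f e.1 e.2)).symm

theorem prod_Ioi_eq_prod_dyads {n : ℕ} (f : Fin n → Fin n → ℝ) :
    ∏ i : Fin n, ∏ j ∈ Finset.Ioi i, f i j = ∏ e ∈ dyads n, f e.1 e.2 :=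
  (Finset.prod_finset_product (dyads n) Finset.univ Finset.Ioi (by simp [dyads])
    (f := fun e => f e.1 e.2)).symm

section Model

variable {n K : ℕ} {J : Finset (Fin n)} {x : Fin n → Fin n → EuclideanSpace ℝ (Fin K)}
  {θ : EuclideanSpace ℝ (Fin K) × ℝ} {a : Fin n → ℝ}

/-- The factor of the dyad `(i, j)` in the likelihood of `g`. -/
noncomputable def dyadFactor (J : Finset (Fin n)) (x : Fin n → Fin n → EuclideanSpace ℝ (Fin K))
    (θ : EuclideanSpace ℝ (Fin K) × ℝ) (a : Fin n → ℝ) (g : SimpleGraph (Fin n))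
    (e : Fin n × Fin n) : ℝ :=
  (1 - linkProb J x θ a g e.1 e.2) ^ (1 - link g e.1 e.2) *
    linkProb J x θ a g e.1 e.2 ^ link g e.1 e.2

/-- The residual `G i j - p i j` of the dyad `(i, j)`. -/
noncomputable def linkResid (J : Finset (Fin n)) (x : Fin n → Fin n → EuclideanSpace ℝ (Fin K))
    (θ : EuclideanSpace ℝ (Fin K) × ℝ) (a : Fin n → ℝ) (g : SimpleGraph (Fin n))
    (e : Fin n × Fin n) : ℝ :=
  (link g e.1 e.2 : ℝ) - linkProb J x θ a g e.1 e.2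

theorem link_eq_zero_or_one (g : SimpleGraph (Fin n)) (i j : Fin n) :
    link g i j = 0 ∨ link g i j = 1 := by
  unfold link; split_ifs <;> simp

theorem linkProb_pos (g : SimpleGraph (Fin n)) (i j : Fin n) : 0 < linkProb J x θ a g i j := by
  unfold linkProb; positivity

theorem one_sub_linkProb (g : SimpleGraph (Fin n)) (i j : Fin n) :
    1 - linkProb J x θ a g i j = 1 / (1 + Real.exp (surplus J x θ a g i j)) := by
  unfold linkProb
  have : 0 < 1 + Real.exp (surplus J x θ a g i j) := by positivity
  field_simp
  ring

theorem linkProb_lt_one (g : SimpleGraph (Fin n)) (i j : Fin n) :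
    linkProb J x θ a g i j < 1 := by
  have : 0 < 1 - linkProb J x θ a g i j := by rw [one_sub_linkProb]; positivity
  linarith

theorem dyadFactor_pos (g : SimpleGraph (Fin n)) (e : Fin n × Fin n) :
    0 < dyadFactor J x θ a g e :=
  mul_pos (pow_pos (sub_pos.2 (linkProb_lt_one ..)) _) (pow_pos (linkProb_pos ..) _)

theorem dyadFactor_le_one (g : SimpleGraph (Fin n)) (e : Fin n × Fin n) :
    dyadFactor J x θ a g e ≤ 1 := by
  have h0 := linkProb_pos (J := J) (x := x) (θ := θ) (a := a) g e.1 e.2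
  have h1 := linkProb_lt_one (J := J) (x := x) (θ := θ) (a := a) g e.1 e.2
  unfold dyadFactor
  rcases link_eq_zero_or_one g e.1 e.2 with h | h <;> rw [h] <;> simp <;> linarith

theorem le_dyadFactor {M : ℝ} {g : SimpleGraph (Fin n)} {e : Fin n × Fin n}
    (hM : |surplus J x θ a g e.1 e.2| ≤ M) :
    1 / (1 + Real.exp M) ≤ dyadFactor J x θ a g e := by
  obtain ⟨h1, h2⟩ := abs_le.1 hM
  unfold dyadFactor
  rcases link_eq_zero_or_one g e.1 e.2 with h | h <;> rw [h]
  · simp only [Nat.sub_zero, pow_one, pow_zero, mul_one, one_sub_linkProb]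
    gcongr
  · simp only [Nat.sub_self, pow_one, pow_zero, one_mul, linkProb]
    rw [div_le_div_iff₀ (by positivity) (by positivity), one_mul, mul_add, mul_one, ← Real.exp_add,
      add_comm 1]
    gcongr
    exact Real.one_le_exp (by linarith)

theorem abs_linkResid_le_one (g : SimpleGraph (Fin n)) (e : Fin n × Fin n) :
    |linkResid J x θ a g e| ≤ 1 := by
  have h0 := linkProb_pos (J := J) (x := x) (θ := θ) (a := a) g e.1 e.2
  have h1 := linkProb_lt_one (J := J) (x := x) (θ := θ) (a := a) g e.1 e.2
  unfold linkResid
  rw [abs_le]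
  rcases link_eq_zero_or_one g e.1 e.2 with h | h <;> rw [h] <;> push_cast <;>
    constructor <;> linarith

theorem likelihood_eq_prod (g : SimpleGraph (Fin n)) :
    likelihood J x θ a g = ∏ e ∈ dyads n, dyadFactor J x θ a g e :=
  prod_Ioi_eq_prod_dyads _

theorem likelihood_nonneg (g : SimpleGraph (Fin n)) : 0 ≤ likelihood J x θ a g := by
  rw [likelihood_eq_prod]
  exact Finset.prod_nonneg fun e _ => (dyadFactor_pos g e).le

theorem logLik_eq_sum (g : SimpleGraph (Fin n)) :
    logLik J x g θ a = ∑ e ∈ dyads n, ((link g e.1 e.2 : ℝ) * surplus J x θ a g e.1 e.2 -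
      Real.log (1 + Real.exp (surplus J x θ a g e.1 e.2))) := by
  unfold logLik
  rw [sum_Ioi_eq_sum_dyads]
  refine Finset.sum_congr rfl fun e _ => ?_
  have h : 0 < 1 + Real.exp (surplus J x θ a g e.1 e.2) := by positivity
  rw [one_sub_linkProb, linkProb, Real.log_div (Real.exp_pos _).ne' h.ne', Real.log_exp,
    Real.log_div one_ne_zero h.ne', Real.log_one]
  ring

/-- A log-likelihood difference is a sum of divergences plus a term linear in the residuals. -/
theorem logLik_sub_logLik (g : SimpleGraph (Fin n)) (θ' : EuclideanSpace ℝ (Fin K) × ℝ)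
    (a' : Fin n → ℝ) :
    logLik J x g θ a - logLik J x g θ' a' =
      ∑ e ∈ dyads n, klLogit (surplus J x θ a g e.1 e.2) (surplus J x θ' a' g e.1 e.2) -
      ∑ e ∈ dyads n, linkResid J x θ a g e *
        (surplus J x θ' a' g e.1 e.2 - surplus J x θ a g e.1 e.2) := by
  rw [logLik_eq_sum, logLik_eq_sum, ← Finset.sum_sub_distrib, ← Finset.sum_sub_distrib]
  refine Finset.sum_congr rfl fun e _ => ?_
  unfold klLogit linkResid linkProb
  ring

/-- The network obtained from `g` by switching the link between `i` and `j`. -/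
def toggle (i j : Fin n) (g : SimpleGraph (Fin n)) : SimpleGraph (Fin n) :=
  symmDiff g (SimpleGraph.edge i j)

theorem toggle_involutive (i j : Fin n) : Function.Involutive (toggle i j) :=
  fun g => symmDiff_symmDiff_cancel_right _ g

theorem toggle_adj {i j : Fin n} (hij : i ≠ j) (g : SimpleGraph (Fin n)) (k l : Fin n) :
    (toggle i j g).Adj k l ↔ Xor (g.Adj k l) ((k = i ∧ l = j) ∨ (k = j ∧ l = i)) := by
  simp only [toggle, symmDiff, SimpleGraph.sup_adj, SimpleGraph.sdiff_adj, SimpleGraph.edge_adj,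
    Xor]
  constructor
  · rintro (⟨h1, h2⟩ | ⟨h1, h2⟩)
    · exact Or.inl ⟨h1, fun h => h2 ⟨by tauto, h1.ne⟩⟩
    · exact Or.inr ⟨by tauto, h2⟩
  · rintro (⟨h1, h2⟩ | ⟨h1, h2⟩)
    · exact Or.inl ⟨h1, fun h => h2 (by tauto)⟩
    · exact Or.inr ⟨⟨by tauto, by rcases h1 with ⟨rfl, rfl⟩ | ⟨rfl, rfl⟩ <;> tauto⟩, h2⟩

theorem link_toggle_self {i j : Fin n} (hij : i ≠ j) (g : SimpleGraph (Fin n)) :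
    link (toggle i j g) i j = 1 - link g i j := by
  by_cases h : g.Adj i j <;> simp [link, toggle_adj hij, Xor, h]

theorem link_toggle_of_ne {i j k l : Fin n} (hij : i ≠ j) (h1 : ¬(k = i ∧ l = j))
    (h2 : ¬(k = j ∧ l = i)) (g : SimpleGraph (Fin n)) :
    link (toggle i j g) k l = link g k l := by
  classical
  unfold link
  exact if_congr (by simp [toggle_adj hij, Xor, h1, h2]) rfl rfl

open scoped Classical in
theorem sum_toggle (i j : Fin n) (f : SimpleGraph (Fin n) → ℝ) :
    ∑ g, f (toggle i j g) = ∑ g, f g :=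
  Equiv.sum_comp (toggle_involutive i j).toPerm f

/-- The common links of `k` and `l` only involve the links of `k` and of `l` with members of `J`. -/
theorem commonLinks_toggle {i j k l : Fin n} (hij : i ≠ j) (hk : ¬(k = i ∧ j ∈ J))
    (hk' : ¬(k = j ∧ i ∈ J)) (hl : ¬(l = i ∧ j ∈ J)) (hl' : ¬(l = j ∧ i ∈ J))
    (g : SimpleGraph (Fin n)) :
    commonLinks J (toggle i j g) k l = commonLinks J g k l := by
  unfold commonLinks
  refine Finset.sum_congr rfl fun r hr => ?_
  rw [link_toggle_of_ne hij (by rintro ⟨h, rfl⟩; exact hk ⟨h, hr⟩)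
      (by rintro ⟨h, rfl⟩; exact hk' ⟨h, hr⟩),
    link_toggle_of_ne hij (by rintro ⟨h, rfl⟩; exact hl ⟨h, hr⟩)
      (by rintro ⟨h, rfl⟩; exact hl' ⟨h, hr⟩)]

theorem linkProb_toggle {i j k l : Fin n} (hij : i ≠ j) (hk : ¬(k = i ∧ j ∈ J))
    (hk' : ¬(k = j ∧ i ∈ J)) (hl : ¬(l = i ∧ j ∈ J)) (hl' : ¬(l = j ∧ i ∈ J))
    (g : SimpleGraph (Fin n)) :
    linkProb J x θ a (toggle i j g) k l = linkProb J x θ a g k l := by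
  unfold linkProb surplus
  rw [commonLinks_toggle hij hk hk' hl hl']

theorem dyadFactor_toggle {i j : Fin n} (hij : i < j) {e : Fin n × Fin n} (he : e ∈ dyads n)
    (hne : e ≠ (i, j)) (hk : ¬(e.1 = i ∧ j ∈ J)) (hk' : ¬(e.1 = j ∧ i ∈ J))
    (hl : ¬(e.2 = i ∧ j ∈ J)) (hl' : ¬(e.2 = j ∧ i ∈ J)) (g : SimpleGraph (Fin n)) :
    dyadFactor J x θ a (toggle i j g) e = dyadFactor J x θ a g e := by
  unfold dyadFactor
  rw [linkProb_toggle hij.ne hk hk' hl hl', link_toggle_of_ne hij.ne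
    (fun h => hne (Prod.ext h.1 h.2))]
  rintro ⟨h1, h2⟩
  have := mem_dyads.1 he
  rw [h1, h2] at this
  exact absurd hij this.asymm

end Model

/-! ### Residuals of the dyads outside the reference set -/

section Noise

variable {n K : ℕ} {J : Finset (Fin n)} {x : Fin n → Fin n → EuclideanSpace ℝ (Fin K)}
  {θ : EuclideanSpace ℝ (Fin K) × ℝ} {a : Fin n → ℝ}

/-- The dyads none of whose members belongs to `J`. -/
def outerDyads (J : Finset (Fin n)) : Finset (Fin n × Fin n) :=
  (dyads n).filter fun e => e.1 ∉ J ∧ e.2 ∉ J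

/-- The dyads with at least one member in `J`. -/
def innerDyads (J : Finset (Fin n)) : Finset (Fin n × Fin n) :=
  (dyads n).filter fun e => ¬(e.1 ∉ J ∧ e.2 ∉ J)

theorem mem_outerDyads {e : Fin n × Fin n} :
    e ∈ outerDyads J ↔ e.1 < e.2 ∧ e.1 ∉ J ∧ e.2 ∉ J := by
  simp [outerDyads, mem_dyads]

theorem mem_innerDyads {e : Fin n × Fin n} :
    e ∈ innerDyads J ↔ e.1 < e.2 ∧ (e.1 ∈ J ∨ e.2 ∈ J) := by
  simp only [innerDyads, Finset.mem_filter, mem_dyads]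
  tauto

theorem outerDyads_subset : outerDyads J ⊆ dyads n := Finset.filter_subset _ _

theorem sum_outer_add_sum_inner (f : Fin n × Fin n → ℝ) :
    ∑ e ∈ outerDyads J, f e + ∑ e ∈ innerDyads J, f e = ∑ e ∈ dyads n, f e :=
  Finset.sum_filter_add_sum_filter_not _ _ _

theorem dyadFactor_toggle_outer {e e' : Fin n × Fin n} (he : e ∈ outerDyads J)
    (he' : e' ∈ dyads n) (hne : e' ≠ e) (g : SimpleGraph (Fin n)) :
    dyadFactor J x θ a (toggle e.1 e.2 g) e' = dyadFactor J x θ a g e' := by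
  obtain ⟨h, h1, h2⟩ := mem_outerDyads.1 he
  exact dyadFactor_toggle h he' hne (fun h => h2 h.2) (fun h => h1 h.2) (fun h => h2 h.2)
    (fun h => h1 h.2) g

theorem linkProb_toggle_outer {e : Fin n × Fin n} (he : e ∈ outerDyads J)
    (i j : Fin n) (g : SimpleGraph (Fin n)) :
    linkProb J x θ a (toggle e.1 e.2 g) i j = linkProb J x θ a g i j := by
  obtain ⟨h, h1, h2⟩ := mem_outerDyads.1 he
  exact linkProb_toggle h.ne (fun h => h2 h.2) (fun h => h1 h.2) (fun h => h2 h.2)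
    (fun h => h1 h.2) g

theorem commonLinks_toggle_outer {e : Fin n × Fin n} (he : e ∈ outerDyads J)
    (i j : Fin n) (g : SimpleGraph (Fin n)) :
    commonLinks J (toggle e.1 e.2 g) i j = commonLinks J g i j := by
  obtain ⟨h, h1, h2⟩ := mem_outerDyads.1 he
  exact commonLinks_toggle h.ne (fun h => h2 h.2) (fun h => h1 h.2) (fun h => h2 h.2)
    (fun h => h1 h.2) g

theorem linkResid_toggle_outer {e e' : Fin n × Fin n} (he : e ∈ outerDyads J)
    (he' : e' ∈ dyads n) (hne : e' ≠ e) (g : SimpleGraph (Fin n)) :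
    linkResid J x θ a (toggle e.1 e.2 g) e' = linkResid J x θ a g e' := by
  have h := (mem_outerDyads.1 he).1
  unfold linkResid
  rw [linkProb_toggle_outer he, link_toggle_of_ne h.ne (fun h => hne (Prod.ext h.1 h.2))]
  rintro ⟨h1, h2⟩
  have := mem_dyads.1 he'
  rw [h1, h2] at this
  exact absurd h this.asymm

open scoped Classical in
/-- Averaging over the link of a single outer dyad `e`: the two values of the factor of `e`
sum to one. -/
theorem sum_dyadFactor_mul {e : Fin n × Fin n} (he : e ∈ outerDyads J)
    {F : SimpleGraph (Fin n) → ℝ} (hF : ∀ g, F (toggle e.1 e.2 g) = F g) :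
    ∑ g, dyadFactor J x θ a g e * F g = 1 / 2 * ∑ g, F g := by
  have h := (mem_outerDyads.1 he).1
  have key : ∀ g, dyadFactor J x θ a g e * F g +
      dyadFactor J x θ a (toggle e.1 e.2 g) e * F (toggle e.1 e.2 g) = F g := by
    intro g
    rw [hF]
    unfold dyadFactor
    rw [linkProb_toggle_outer he, link_toggle_self h.ne]
    rcases link_eq_zero_or_one g e.1 e.2 with h | h <;> rw [h] <;> simp <;> ring
  have h2 := Finset.sum_congr rfl fun g (_ : g ∈ Finset.univ) => key g
  rw [Finset.sum_add_distrib, sum_toggle e.1 e.2 (fun g => dyadFactor J x θ a g e * F g)] at h2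
  linarith

open scoped Classical in
/-- The residual of an outer dyad has mean zero given all other links. -/
theorem sum_likelihood_mul_linkResid_mul {e : Fin n × Fin n} (he : e ∈ outerDyads J)
    {F : SimpleGraph (Fin n) → ℝ} (hF : ∀ g, F (toggle e.1 e.2 g) = F g) :
    ∑ g, likelihood J x θ a g * (linkResid J x θ a g e * F g) = 0 := by
  have h := (mem_outerDyads.1 he).1
  have key : ∀ g, likelihood J x θ a g * (linkResid J x θ a g e * F g) +
      likelihood J x θ a (toggle e.1 e.2 g) *
        (linkResid J x θ a (toggle e.1 e.2 g) e * F (toggle e.1 e.2 g)) = 0 := by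
    intro g
    rw [hF, likelihood_eq_prod, likelihood_eq_prod,
      ← Finset.mul_prod_erase _ _ (outerDyads_subset he),
      ← Finset.mul_prod_erase _ _ (outerDyads_subset he),
      Finset.prod_congr rfl fun e' he' => dyadFactor_toggle_outer he
        (Finset.mem_of_mem_erase he') (Finset.ne_of_mem_erase he') g]
    unfold linkResid
    rw [dyadFactor, dyadFactor, linkProb_toggle_outer he, link_toggle_self h.ne]
    rcases link_eq_zero_or_one g e.1 e.2 with h | h <;> rw [h] <;> simp <;> ring
  have h2 := Finset.sum_congr rfl fun g (_ : g ∈ Finset.univ) => key g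
  rw [Finset.sum_add_distrib, sum_toggle e.1 e.2
    (fun g => likelihood J x θ a g * (linkResid J x θ a g e * F g))] at h2
  simp only [Finset.sum_const_zero] at h2
  linarith

open scoped Classical in
/-- Residuals of distinct outer dyads are uncorrelated, also after weighting them with
coefficients that do not depend on the outer links. -/
theorem sum_likelihood_mul_norm_sq_le {V : Type*} [NormedAddCommGroup V] [InnerProductSpace ℝ V]
    (hP : ∑ g, likelihood J x θ a g = 1) {T : Finset (Fin n × Fin n)} (hT : T ⊆ outerDyads J)
    {v : SimpleGraph (Fin n) → Fin n × Fin n → V} {D : ℝ}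
    (hv : ∀ e ∈ outerDyads J, ∀ e' g, v (toggle e.1 e.2 g) e' = v g e')
    (hD : ∀ g, ∀ e ∈ T, ‖v g e‖ ≤ D) :
    ∑ g, likelihood J x θ a g * ‖∑ e ∈ T, linkResid J x θ a g e • v g e‖ ^ 2 ≤
      (T.card : ℝ) * D ^ 2 := by
  have expand : ∀ g, likelihood J x θ a g * ‖∑ e ∈ T, linkResid J x θ a g e • v g e‖ ^ 2 =
      ∑ e ∈ T, ∑ f ∈ T, likelihood J x θ a g *
        (linkResid J x θ a g e * (linkResid J x θ a g f * inner ℝ (v g e) (v g f))) := by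
    intro g
    rw [← real_inner_self_eq_norm_sq, sum_inner, Finset.mul_sum]
    refine Finset.sum_congr rfl fun e _ => ?_
    rw [inner_sum, Finset.mul_sum]
    refine Finset.sum_congr rfl fun f _ => ?_
    rw [real_inner_smul_left, real_inner_smul_right]
  rw [Finset.sum_congr rfl fun g _ => expand g, Finset.sum_comm]
  have hterm : ∀ e ∈ T, ∑ g, ∑ f ∈ T, likelihood J x θ a g *
      (linkResid J x θ a g e * (linkResid J x θ a g f * inner ℝ (v g e) (v g f))) ≤ D ^ 2 := by
    intro e he
    rw [Finset.sum_comm, Finset.sum_eq_single_of_mem e he]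
    · rw [← one_mul (D ^ 2), ← hP, Finset.sum_mul]
      refine Finset.sum_le_sum fun g _ => ?_
      refine mul_le_mul_of_nonneg_left ?_ (likelihood_nonneg g)
      rw [real_inner_self_eq_norm_sq, ← mul_assoc, ← abs_mul_abs_self]
      have h1 := abs_linkResid_le_one (J := J) (x := x) (θ := θ) (a := a) g e
      have h2 := hD g e he
      calc _ ≤ 1 * ‖v g e‖ ^ 2 := by
            gcongr
            exact mul_le_one₀ h1 (abs_nonneg _) h1
        _ ≤ D ^ 2 := by rw [one_mul]; gcongr
    · intro f hf hne
      refine sum_likelihood_mul_linkResid_mul (hT he) fun g => ?_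
      rw [hv _ (hT he), hv _ (hT he),
        linkResid_toggle_outer (hT he) (outerDyads_subset (hT hf)) hne]
  calc _ ≤ ∑ _e ∈ T, D ^ 2 := Finset.sum_le_sum hterm
    _ = _ := by rw [Finset.sum_const, nsmul_eq_mul]

open scoped Classical in
theorem sum_likelihood_mul_norm_le {V : Type*} [NormedAddCommGroup V] [InnerProductSpace ℝ V]
    (hP : ∑ g, likelihood J x θ a g = 1) {T : Finset (Fin n × Fin n)} (hT : T ⊆ outerDyads J)
    {v : SimpleGraph (Fin n) → Fin n × Fin n → V} {D : ℝ} (hD0 : 0 ≤ D)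
    (hv : ∀ e ∈ outerDyads J, ∀ e' g, v (toggle e.1 e.2 g) e' = v g e')
    (hD : ∀ g, ∀ e ∈ T, ‖v g e‖ ≤ D) :
    ∑ g, likelihood J x θ a g * ‖∑ e ∈ T, linkResid J x θ a g e • v g e‖ ≤
      Real.sqrt T.card * D := by
  have h2 := sum_likelihood_mul_norm_sq_le hP hT hv hD
  have hcs := Finset.sum_mul_sq_le_sq_mul_sq Finset.univ
    (fun g => Real.sqrt (likelihood J x θ a g))
    (fun g => Real.sqrt (likelihood J x θ a g) * ‖∑ e ∈ T, linkResid J x θ a g e • v g e‖)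
  simp only [mul_pow, ← mul_assoc, Real.mul_self_sqrt (likelihood_nonneg _),
    Real.sq_sqrt (likelihood_nonneg _), hP, one_mul] at hcs
  refine le_of_abs_le (abs_le_of_sq_le_sq ?_ (by positivity))
  rw [mul_pow, Real.sq_sqrt (Nat.cast_nonneg _)]
  exact hcs.trans h2

end Noise

/-! ### Links with the reference set -/

section Patterns

variable {n K : ℕ} {J : Finset (Fin n)} {x : Fin n → Fin n → EuclideanSpace ℝ (Fin K)}
  {θ : EuclideanSpace ℝ (Fin K) × ℝ} {a : Fin n → ℝ}

open scoped Classical in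
/-- Summing out the links of the outer dyads: up to a constant, the links with the members of `J`
have weight the product of the factors of the inner dyads. -/
theorem sum_likelihood_mul_eq {F : SimpleGraph (Fin n) → ℝ}
    (hF : ∀ e ∈ outerDyads J, ∀ g, F (toggle e.1 e.2 g) = F g) :
    ∑ g, likelihood J x θ a g * F g = (1 / 2) ^ (outerDyads J).card *
      ∑ g, (∏ e ∈ innerDyads J, dyadFactor J x θ a g e) * F g := by
  have hsplit : ∀ g, likelihood J x θ a g = (∏ e ∈ outerDyads J, dyadFactor J x θ a g e) *
      ∏ e ∈ innerDyads J, dyadFactor J x θ a g e := fun g => by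
    rw [likelihood_eq_prod]
    exact (Finset.prod_filter_mul_prod_filter_not _ _ _).symm
  have main : ∀ T ⊆ outerDyads J, ∑ g, (∏ e ∈ T, dyadFactor J x θ a g e) *
      ((∏ e ∈ innerDyads J, dyadFactor J x θ a g e) * F g) = (1 / 2) ^ T.card *
      ∑ g, (∏ e ∈ innerDyads J, dyadFactor J x θ a g e) * F g := by
    intro T
    induction T using Finset.induction_on with
    | empty => intro _; simp
    | insert e T heT ih =>
      intro hT
      have he : e ∈ outerDyads J := hT (Finset.mem_insert_self _ _)
      have hT' : T ⊆ outerDyads J := fun f hf => hT (Finset.mem_insert_of_mem hf)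
      have hin : ∀ f ∈ innerDyads J, ∀ g, dyadFactor J x θ a (toggle e.1 e.2 g) f =
          dyadFactor J x θ a g f := fun f hf g =>
        dyadFactor_toggle_outer he (Finset.mem_filter.1 hf).1
          (fun h => (Finset.mem_filter.1 hf).2 (h ▸ (Finset.mem_filter.1 he).2)) g
      simp only [Finset.prod_insert heT, Finset.card_insert_of_notMem heT, mul_assoc]
      rw [sum_dyadFactor_mul he, ih hT', pow_succ]
      · ring
      · intro g
        rw [hF e he, Finset.prod_congr rfl fun f hf => dyadFactor_toggle_outer he
          (outerDyads_subset (hT' hf)) (fun h => heT (h ▸ hf)) g,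
          Finset.prod_congr rfl fun f hf => hin f hf g]
  rw [← main _ subset_rfl]
  refine Finset.sum_congr rfl fun g _ => ?_
  rw [hsplit, mul_assoc]

/-- Switching a link between `i ∉ J` and `k ∈ J` only affects the factors of the at most `|J|`
inner dyads that contain `i`. -/
theorem prod_innerDyads_toggle_le {ρ : ℝ} (hρ : 0 < ρ) {m : ℕ} (hm : J.card ≤ m) (hρ1 : ρ ≤ 1)
    (hfac : ∀ g, ∀ e ∈ dyads n, ρ ≤ dyadFactor J x θ a g e) {i k : Fin n} (hi : i ∉ J)
    (hk : k ∈ J) (g : SimpleGraph (Fin n)) :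
    ρ ^ m * ∏ e ∈ innerDyads J, dyadFactor J x θ a (toggle i k g) e ≤
      ∏ e ∈ innerDyads J, dyadFactor J x θ a g e := by
  have hik : i ≠ k := fun h => hi (h ▸ hk)
  rw [← Finset.prod_filter_mul_prod_filter_not (innerDyads J) (fun e => e.1 = i ∨ e.2 = i),
    ← Finset.prod_filter_mul_prod_filter_not (innerDyads J) (fun e => e.1 = i ∨ e.2 = i)
      (dyadFactor J x θ a g)]
  have hrest : ∏ e ∈ (innerDyads J).filter (fun e => ¬(e.1 = i ∨ e.2 = i)),
      dyadFactor J x θ a (toggle i k g) e =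
      ∏ e ∈ (innerDyads J).filter (fun e => ¬(e.1 = i ∨ e.2 = i)), dyadFactor J x θ a g e := by
    refine Finset.prod_congr rfl fun e he => ?_
    obtain ⟨-, h2⟩ := Finset.mem_filter.1 he
    push Not at h2
    unfold dyadFactor
    rw [linkProb_toggle hik (fun h => h2.1 h.1) (fun h => hi h.2) (fun h => h2.2 h.1)
      (fun h => hi h.2), link_toggle_of_ne hik (fun h => h2.1 h.1) (fun h => h2.2 h.2)]
  have hcard : ((innerDyads J).filter fun e => e.1 = i ∨ e.2 = i).card ≤ m := by
    refine le_trans (Finset.card_le_card (t := J.image fun l => if i < l then (i, l) else (l, i))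
      ?_) (Finset.card_image_le.trans hm)
    intro e he
    obtain ⟨h1, h2⟩ := Finset.mem_filter.1 he
    obtain ⟨h3, h4⟩ := mem_innerDyads.1 h1
    rw [Finset.mem_image]
    rcases h2 with rfl | rfl
    · exact ⟨e.2, h4.resolve_left hi, by simp [h3]⟩
    · exact ⟨e.1, h4.resolve_right hi, by simp [h3.asymm]⟩
  rw [hrest, ← mul_assoc]
  refine mul_le_mul_of_nonneg_right ?_ (Finset.prod_nonneg fun e _ => (dyadFactor_pos g e).le)
  calc _ ≤ ρ ^ m * 1 := by
        gcongr
        exact Finset.prod_le_one (fun e _ => (dyadFactor_pos _ e).le)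
          fun e _ => dyadFactor_le_one _ e
    _ ≤ ρ ^ ((innerDyads J).filter fun e => e.1 = i ∨ e.2 = i).card := by
        rw [mul_one]
        exact pow_le_pow_of_le_one hρ.le hρ1 hcard
    _ ≤ _ := by
        rw [← Finset.prod_const]
        exact Finset.prod_le_prod (fun _ _ => hρ.le) fun e he =>
          hfac g e (Finset.mem_filter.1 (Finset.mem_filter.1 he).1).1

/-- The indicator that the links in `S` have the values prescribed by `t`. -/
noncomputable def patternInd (S : Finset (Fin n × Fin n)) (t : Fin n × Fin n → ℕ)
    (g : SimpleGraph (Fin n)) : ℝ :=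
  ∏ p ∈ S, if link g p.1 p.2 = t p then 1 else 0

theorem patternInd_nonneg (S : Finset (Fin n × Fin n)) (t : Fin n × Fin n → ℕ)
    (g : SimpleGraph (Fin n)) : 0 ≤ patternInd S t g :=
  Finset.prod_nonneg fun p _ => by split_ifs <;> simp

theorem patternInd_le_one (S : Finset (Fin n × Fin n)) (t : Fin n × Fin n → ℕ)
    (g : SimpleGraph (Fin n)) : patternInd S t g ≤ 1 :=
  Finset.prod_le_one (fun p _ => by split_ifs <;> simp) fun p _ => by split_ifs <;> simp

theorem patternInd_eq_one_of_ne_zero {S : Finset (Fin n × Fin n)} {t : Fin n × Fin n → ℕ}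
    {g : SimpleGraph (Fin n)} (h : patternInd S t g ≠ 0) {p : Fin n × Fin n} (hp : p ∈ S) :
    link g p.1 p.2 = t p := by
  by_contra hne
  exact h (Finset.prod_eq_zero hp (if_neg hne))

theorem patternInd_toggle {S : Finset (Fin n × Fin n)} {t : Fin n × Fin n → ℕ} {i j : Fin n}
    (hij : i ≠ j) (h1 : (i, j) ∉ S) (h2 : (j, i) ∉ S) (g : SimpleGraph (Fin n)) :
    patternInd S t (toggle i j g) = patternInd S t g := by
  refine Finset.prod_congr rfl fun p hp => ?_
  rw [link_toggle_of_ne hij]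
  · rintro ⟨rfl, rfl⟩; exact h1 hp
  · rintro ⟨rfl, rfl⟩; exact h2 hp

theorem patternInd_toggle_outer {S : Finset (Fin n × Fin n)} (hS : ∀ p ∈ S, p.2 ∈ J)
    {t : Fin n × Fin n → ℕ} {e : Fin n × Fin n} (he : e ∈ outerDyads J)
    (g : SimpleGraph (Fin n)) :
    patternInd S t (toggle e.1 e.2 g) = patternInd S t g := by
  obtain ⟨h, h1, h2⟩ := mem_outerDyads.1 he
  exact patternInd_toggle h.ne (fun h => h2 (hS _ h)) (fun h => h1 (hS _ h)) g

open scoped Classical in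
/-- One prescribed link between `i ∉ J` and `k ∈ J` has conditional probability at least `ρ ^ m / 2`
given the other links with `J`: switching it multiplies the weight of the inner links by at most
`ρ⁻¹ ^ m`. -/
theorem le_sum_likelihood_mul_single {ρ : ℝ} (hρ : 0 < ρ) {m : ℕ} (hm : J.card ≤ m)
    (hρ1 : ρ ≤ 1) (hfac : ∀ g, ∀ e ∈ dyads n, ρ ≤ dyadFactor J x θ a g e) {i k : Fin n}
    (hi : i ∉ J) (hk : k ∈ J) {b : ℕ} (hb : b = 0 ∨ b = 1) {F : SimpleGraph (Fin n) → ℝ}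
    (hF0 : ∀ g, 0 ≤ F g) (hF : ∀ e ∈ outerDyads J, ∀ g, F (toggle e.1 e.2 g) = F g)
    (hFik : ∀ g, F (toggle i k g) = F g) :
    ρ ^ m / 2 * ∑ g, likelihood J x θ a g * F g ≤
      ∑ g, likelihood J x θ a g * ((if link g i k = b then 1 else 0) * F g) := by
  have hik : i ≠ k := fun h => hi (h ▸ hk)
  set h : SimpleGraph (Fin n) → ℝ := fun g => ∏ e ∈ innerDyads J, dyadFactor J x θ a g e with hh
  have hh0 : ∀ g, 0 ≤ h g := fun g => Finset.prod_nonneg fun e _ => (dyadFactor_pos g e).le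
  rw [sum_likelihood_mul_eq hF, sum_likelihood_mul_eq]
  swap
  · intro e he g
    obtain ⟨h0, h1, h2⟩ := mem_outerDyads.1 he
    rw [hF e he, link_toggle_of_ne h0.ne]
    · rintro ⟨-, rfl⟩; exact h2 hk
    · rintro ⟨-, rfl⟩; exact h1 hk
  rw [mul_left_comm]
  refine mul_le_mul_of_nonneg_left ?_ (by positivity)
  have hsum : ∑ g, h g * F g = ∑ g, h g * ((if link g i k = b then 1 else 0) * F g) +
      ∑ g, h (toggle i k g) * ((if link g i k = b then 1 else 0) * F g) := by
    have := sum_toggle i k fun g => h g * ((if link g i k = b then 0 else 1) * F g)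
    have hcongr : ∀ g, h (toggle i k g) *
        ((if link (toggle i k g) i k = b then 0 else 1) * F (toggle i k g)) =
        h (toggle i k g) * ((if link g i k = b then 1 else 0) * F g) := by
      intro g
      rw [hFik, link_toggle_self hik]
      rcases link_eq_zero_or_one g i k with h0 | h0 <;> rcases hb with rfl | rfl <;> simp [h0]
    rw [← Finset.sum_congr rfl fun g _ => hcongr g, this, ← Finset.sum_add_distrib]
    refine Finset.sum_congr rfl fun g _ => ?_
    split_ifs <;> ring
  have hle : ρ ^ m * ∑ g, h (toggle i k g) * ((if link g i k = b then 1 else 0) * F g) ≤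
      ∑ g, h g * ((if link g i k = b then 1 else 0) * F g) := by
    rw [Finset.mul_sum]
    refine Finset.sum_le_sum fun g _ => ?_
    rw [← mul_assoc]
    refine mul_le_mul_of_nonneg_right
      (prod_innerDyads_toggle_le hρ hm hρ1 hfac hi hk g) (mul_nonneg ?_ (hF0 g))
    split_ifs <;> simp
  have hle1 : ρ ^ m * ∑ g, h g * ((if link g i k = b then 1 else 0) * F g) ≤
      ∑ g, h g * ((if link g i k = b then 1 else 0) * F g) := by
    refine mul_le_of_le_one_left (Finset.sum_nonneg fun g _ => mul_nonneg (hh0 g)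
      (mul_nonneg ?_ (hF0 g))) (pow_le_one₀ hρ.le hρ1)
    split_ifs <;> simp
  have hgoal : ρ ^ m / 2 * ∑ g, h g * F g ≤
      ∑ g, h g * ((if link g i k = b then 1 else 0) * F g) := by
    rw [hsum]; linarith
  exact hgoal

open scoped Classical in
/-- Any prescribed values of the links in `S`, all of them between a member of `J` and a player
outside `J`, have conditional probability bounded below given the other links with `J`. -/
theorem le_sum_likelihood_mul_patternInd {ρ : ℝ} (hρ : 0 < ρ) {m : ℕ} (hm : J.card ≤ m)
    (hρ1 : ρ ≤ 1) (hfac : ∀ g, ∀ e ∈ dyads n, ρ ≤ dyadFactor J x θ a g e)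
    {S : Finset (Fin n × Fin n)} {t : Fin n × Fin n → ℕ} (ht : ∀ p, t p = 0 ∨ t p = 1) :
    ∀ {F : SimpleGraph (Fin n) → ℝ}, (∀ p ∈ S, p.1 ∉ J ∧ p.2 ∈ J) →
    (∀ g, 0 ≤ F g) → (∀ e ∈ outerDyads J, ∀ g, F (toggle e.1 e.2 g) = F g) →
    (∀ p ∈ S, ∀ g, F (toggle p.1 p.2 g) = F g) →
    (ρ ^ m / 2) ^ S.card * ∑ g, likelihood J x θ a g * F g ≤
      ∑ g, likelihood J x θ a g * (patternInd S t g * F g) := by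
  induction S using Finset.induction_on with
  | empty => intro F _ _ _ _; simp [patternInd]
  | insert p S hp ih =>
    intro F hS hF0 hF hFS
    obtain ⟨hp1, hp2⟩ := hS p (Finset.mem_insert_self _ _)
    have hS' : ∀ q ∈ S, q.1 ∉ J ∧ q.2 ∈ J := fun q hq => hS q (Finset.mem_insert_of_mem hq)
    have h1 := le_sum_likelihood_mul_single (b := t p) hρ hm hρ1 hfac hp1 hp2 (ht p) hF0 hF
      (hFS p (Finset.mem_insert_self _ _))
    have h2 := ih (F := fun g => (if link g p.1 p.2 = t p then 1 else 0) * F g) hS' ?_ ?_ ?_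
    · rw [Finset.card_insert_of_notMem hp, pow_succ, mul_assoc]
      refine (mul_le_mul_of_nonneg_left h1 (by positivity)).trans (h2.trans_eq ?_)
      refine Finset.sum_congr rfl fun g _ => ?_
      rw [patternInd, patternInd, Finset.prod_insert hp]
      ring
    · intro g
      refine mul_nonneg ?_ (hF0 g)
      split_ifs <;> simp
    · intro e he g
      obtain ⟨h0, h3, h4⟩ := mem_outerDyads.1 he
      rw [hF e he, link_toggle_of_ne h0.ne (fun h => h4 (h.2 ▸ hp2)) (fun h => h3 (h.2 ▸ hp2))]
    · intro q hq g
      obtain ⟨hq1, hq2⟩ := hS' q hq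
      rw [hFS q (Finset.mem_insert_of_mem hq), link_toggle_of_ne (ne_of_mem_of_not_mem hq2 hq1).symm
        (fun h => hp ((Prod.ext h.1 h.2 : p = q) ▸ hq)) (fun h => hp1 (h.1 ▸ hq2))]

open scoped Classical in
/-- The probability that none of the disjoint patterns `S r`, among those `r` with `w r = 1`, is
realized decreases geometrically with the number of such `r`. -/
theorem sum_likelihood_mul_prod_le {ρ : ℝ} (hρ : 0 < ρ) {m : ℕ} (hm : J.card ≤ m)
    (hρ1 : ρ ≤ 1) (hfac : ∀ g, ∀ e ∈ dyads n, ρ ≤ dyadFactor J x θ a g e)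
    (hP : ∑ g, likelihood J x θ a g = 1) {ι : Type*} {S : ι → Finset (Fin n × Fin n)} {s : ℕ}
    (hcard : ∀ r, (S r).card ≤ s) (hS : ∀ r, ∀ p ∈ S r, p.1 ∉ J ∧ p.2 ∈ J)
    (hdisj : ∀ r r', r ≠ r' → Disjoint (S r) (S r')) {t : Fin n × Fin n → ℕ}
    (ht : ∀ p, t p = 0 ∨ t p = 1) {w : ι → ℝ} (hw0 : ∀ r, 0 ≤ w r) (hw1 : ∀ r, w r ≤ 1)
    (A : Finset ι) :
    ∑ g, likelihood J x θ a g * ∏ r ∈ A, (1 - w r * patternInd (S r) t g) ≤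
      ∏ r ∈ A, (1 - (ρ ^ m / 2) ^ s * w r) := by
  have hc0 : 0 ≤ ρ ^ m / 2 := by positivity
  have hc1 : ρ ^ m / 2 ≤ 1 := by
    have := pow_le_one₀ hρ.le hρ1 (n := m)
    linarith
  have hterm : ∀ r g, 0 ≤ 1 - w r * patternInd (S r) t g := fun r g =>
    sub_nonneg.2 (mul_le_one₀ (hw1 r) (patternInd_nonneg _ _ _) (patternInd_le_one _ _ _))
  induction A using Finset.induction_on with
  | empty => simp [hP]
  | insert r A hr ih =>
    set F : SimpleGraph (Fin n) → ℝ := fun g => ∏ r ∈ A, (1 - w r * patternInd (S r) t g)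
    have hF0 : ∀ g, 0 ≤ F g := fun g => Finset.prod_nonneg fun r _ => hterm r g
    have key := le_sum_likelihood_mul_patternInd (F := F) (S := S r) hρ hm hρ1 hfac ht (hS r)
      hF0 ?_ ?_
    · have hsum0 : 0 ≤ ∑ g, likelihood J x θ a g * F g :=
        Finset.sum_nonneg fun g _ => mul_nonneg (likelihood_nonneg g) (hF0 g)
      have hpow : (ρ ^ m / 2) ^ s ≤ (ρ ^ m / 2) ^ (S r).card :=
        pow_le_pow_of_le_one hc0 hc1 (hcard r)
      have hfactor : 0 ≤ 1 - (ρ ^ m / 2) ^ s * w r :=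
        sub_nonneg.2 (mul_le_one₀ (pow_le_one₀ hc0 hc1) (hw0 r) (hw1 r))
      rw [Finset.prod_insert hr]
      calc _ = ∑ g, likelihood J x θ a g * F g -
            w r * ∑ g, likelihood J x θ a g * (patternInd (S r) t g * F g) := by
            rw [Finset.mul_sum, ← Finset.sum_sub_distrib]
            refine Finset.sum_congr rfl fun g _ => ?_
            rw [Finset.prod_insert hr]
            ring
        _ ≤ ∑ g, likelihood J x θ a g * F g -
            w r * ((ρ ^ m / 2) ^ s * ∑ g, likelihood J x θ a g * F g) := by
            refine sub_le_sub_left (mul_le_mul_of_nonneg_left ?_ (hw0 r)) _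
            exact (mul_le_mul_of_nonneg_right hpow hsum0).trans key
        _ = (1 - (ρ ^ m / 2) ^ s * w r) * ∑ g, likelihood J x θ a g * F g := by ring
        _ ≤ _ := mul_le_mul_of_nonneg_left ih hfactor
    · intro e he g
      refine Finset.prod_congr rfl fun r' _ => ?_
      rw [patternInd_toggle_outer (fun p hp => (hS r' p hp).2) he]
    · intro p hp g
      refine Finset.prod_congr rfl fun r' hr' => ?_
      obtain ⟨hp1, hp2⟩ := hS r p hp
      rw [patternInd_toggle (ne_of_mem_of_not_mem hp2 hp1).symm]
      · exact fun h => Finset.disjoint_left.1 (hdisj r r' fun h' => hr (h' ▸ hr')) hp h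
      · exact fun h => hp1 (hS r' _ h).2

end Patterns

/-! ### Separation of the parameters by a tuple of players -/

section Separation

variable {n K : ℕ} {J : Finset (Fin n)} {x : Fin n → Fin n → EuclideanSpace ℝ (Fin K)}
  {θ : EuclideanSpace ℝ (Fin K) × ℝ} {a : Fin n → ℝ}

/-- The population criterion only depends on the parameter through the surpluses. -/
theorem popCriterion_congr {θ₀ θ' : EuclideanSpace ℝ (Fin K) × ℝ} {a₀ a' : Fin n → ℝ}
    (h : ∀ g, ∀ e ∈ dyads n, surplus J x θ a g e.1 e.2 = surplus J x θ' a' g e.1 e.2) :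
    popCriterion J x θ₀ a₀ θ a = popCriterion J x θ₀ a₀ θ' a' := by
  unfold popCriterion
  refine Finset.sum_congr rfl fun g _ => ?_
  rw [logLik_eq_sum, logLik_eq_sum,
    Finset.sum_congr rfl fun e he => by rw [h g e he]]

theorem eq_of_isJointlyIdentified {Θ : Set (EuclideanSpace ℝ (Fin K) × ℝ)} {I : Set ℝ}
    {θ₀ : EuclideanSpace ℝ (Fin K) × ℝ} {a₀ : Fin n → ℝ}
    (hid : IsJointlyIdentified J x Θ I θ₀ a₀) (hθ : θ ∈ Θ) (ha : ∀ i, a i ∈ I)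
    (h : ∀ g, ∀ e ∈ dyads n, surplus J x θ a g e.1 e.2 = surplus J x θ₀ a₀ g e.1 e.2) :
    θ = θ₀ := by
  by_contra hne
  have := hid θ hθ a ha fun h' => hne (Prod.ext_iff.1 h').1
  exact this.ne (popCriterion_congr h)

/-- Identification forces the reference set to be non-empty: otherwise `δ` never matters. -/
theorem nonempty_of_isJointlyIdentified {𝔸 : Set (EuclideanSpace ℝ (Fin K))} {𝔹 I : Set ℝ}
    {β₀ : EuclideanSpace ℝ (Fin K)} {δ₀ : ℝ} {a₀ : Fin n → ℝ} (hβ₀ : β₀ ∈ 𝔸)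
    (hδ₀ : δ₀ ∈ interior 𝔹) (ha₀ : ∀ i, a₀ i ∈ I)
    (hid : IsJointlyIdentified J x (𝔸 ×ˢ 𝔹) I (β₀, δ₀) a₀) : J.Nonempty := by
  rw [Finset.nonempty_iff_ne_empty]
  rintro rfl
  have hnhds : ∀ᶠ δ in 𝓝[≠] δ₀, δ ∈ 𝔹 ∧ δ ≠ δ₀ :=
    (eventually_nhdsWithin_of_eventually_nhds (mem_interior_iff_mem_nhds.1 hδ₀)).and
      eventually_mem_nhdsWithin
  obtain ⟨δ, hδ, hne⟩ := hnhds.exists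
  have := eq_of_isJointlyIdentified (θ := (β₀, δ)) hid ⟨hβ₀, hδ⟩ ha₀ fun g e _ => by
    simp [surplus, commonLinks]
  exact hne (Prod.ext_iff.1 this).2

/-- The surplus of a pair in a tuple of `N + 2` players whose last two members have exactly one
common link with the reference set, while the first `N` members have none. -/
noncomputable def tupleSurplus {N : ℕ} (x : Fin (N + 2) → Fin (N + 2) → EuclideanSpace ℝ (Fin K))
    (θ : EuclideanSpace ℝ (Fin K) × ℝ) (a : Fin (N + 2) → ℝ) (i j : Fin (N + 2)) : ℝ :=
  (if N ≤ (i : ℕ) ∧ N ≤ (j : ℕ) then 1 else 0) * θ.2 + inner ℝ (x i j) θ.1 + (a i + a j)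

/-- The divergence of `(θ, a)` from `(θ₀, a₀)` summed over the pairs of such a tuple. -/
noncomputable def tupleDiv {N : ℕ} (θ₀ : EuclideanSpace ℝ (Fin K) × ℝ)
    (x : Fin (N + 2) → Fin (N + 2) → EuclideanSpace ℝ (Fin K)) (a₀ : Fin (N + 2) → ℝ)
    (θ : EuclideanSpace ℝ (Fin K) × ℝ) (a : Fin (N + 2) → ℝ) : ℝ :=
  ∑ e ∈ dyads (N + 2), klLogit (tupleSurplus x θ₀ a₀ e.1 e.2) (tupleSurplus x θ a e.1 e.2)

/-- The smallest divergence from `(θ₀, a₀)` over the parameters at distance at least `ε` from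
`θ₀`. -/
noncomputable def tupleGap {N : ℕ} (Θ : Set (EuclideanSpace ℝ (Fin K) × ℝ)) (I : Set ℝ) (ε : ℝ)
    (θ₀ : EuclideanSpace ℝ (Fin K) × ℝ)
    (x : Fin (N + 2) → Fin (N + 2) → EuclideanSpace ℝ (Fin K)) (a₀ : Fin (N + 2) → ℝ) : ℝ :=
  sInf ((fun p : (EuclideanSpace ℝ (Fin K) × ℝ) × (Fin (N + 2) → ℝ) =>
    tupleDiv θ₀ x a₀ p.1 p.2) '' ((Θ ∩ {θ | ε ≤ dist θ θ₀}) ×ˢ Set.univ.pi fun _ => I))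

theorem tupleDiv_nonneg {N : ℕ} (θ₀ : EuclideanSpace ℝ (Fin K) × ℝ)
    (x : Fin (N + 2) → Fin (N + 2) → EuclideanSpace ℝ (Fin K)) (a₀ : Fin (N + 2) → ℝ)
    (θ : EuclideanSpace ℝ (Fin K) × ℝ) (a : Fin (N + 2) → ℝ) : 0 ≤ tupleDiv θ₀ x a₀ θ a :=
  Finset.sum_nonneg fun _ _ => klLogit_nonneg _ _

theorem tupleGap_le {N : ℕ} {Θ : Set (EuclideanSpace ℝ (Fin K) × ℝ)} {I : Set ℝ} {ε : ℝ}
    {θ₀ : EuclideanSpace ℝ (Fin K) × ℝ} {θ : EuclideanSpace ℝ (Fin K) × ℝ}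
    (x : Fin (N + 2) → Fin (N + 2) → EuclideanSpace ℝ (Fin K)) (a₀ : Fin (N + 2) → ℝ)
    {a : Fin (N + 2) → ℝ} (hθ : θ ∈ Θ) (hε : ε ≤ dist θ θ₀) (ha : ∀ i, a i ∈ I) :
    tupleGap Θ I ε θ₀ x a₀ ≤ tupleDiv θ₀ x a₀ θ a := by
  refine csInf_le ⟨0, ?_⟩ ⟨(θ, a), ⟨⟨hθ, hε⟩, fun i _ => ha i⟩, rfl⟩
  rintro _ ⟨p, -, rfl⟩
  exact tupleDiv_nonneg ..

theorem continuous_tupleDiv {N : ℕ} (θ₀ : EuclideanSpace ℝ (Fin K) × ℝ) :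
    Continuous fun q : ((Fin (N + 2) → Fin (N + 2) → EuclideanSpace ℝ (Fin K)) ×
      (Fin (N + 2) → ℝ)) × ((EuclideanSpace ℝ (Fin K) × ℝ) × (Fin (N + 2) → ℝ)) =>
      tupleDiv θ₀ q.1.1 q.1.2 q.2.1 q.2.2 := by
  unfold tupleDiv tupleSurplus
  refine continuous_finsetSum _ fun e _ => ?_
  refine continuous_klLogit.comp (Continuous.prodMk ?_ ?_)
  · fun_prop
  · fun_prop

theorem isCompact_far {N : ℕ} {Θ : Set (EuclideanSpace ℝ (Fin K) × ℝ)} {I : Set ℝ}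
    (hΘ : IsCompact Θ) (hI : IsCompact I) (ε : ℝ) (θ₀ : EuclideanSpace ℝ (Fin K) × ℝ) :
    IsCompact ((Θ ∩ {θ | ε ≤ dist θ θ₀}) ×ˢ Set.univ.pi fun _ : Fin (N + 2) => I) :=
  (hΘ.inter_right (isClosed_le continuous_const (by fun_prop))).prod
    (isCompact_univ_pi fun _ => hI)

theorem continuous_tupleGap {N : ℕ} {Θ : Set (EuclideanSpace ℝ (Fin K) × ℝ)} {I : Set ℝ}
    (hΘ : IsCompact Θ) (hI : IsCompact I) (ε : ℝ) (θ₀ : EuclideanSpace ℝ (Fin K) × ℝ) :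
    Continuous fun q : (Fin (N + 2) → Fin (N + 2) → EuclideanSpace ℝ (Fin K)) ×
      (Fin (N + 2) → ℝ) => tupleGap Θ I ε θ₀ q.1 q.2 :=
  (isCompact_far hΘ hI ε θ₀).continuous_sInf (continuous_tupleDiv θ₀)

/-- If the first `N ≥ 2` players are jointly identified, then a tuple of `N + 2` players separates
`θ₀` from all parameters at distance at least `ε`: the pairs of the first `N` players determine
`β`, and then a four-cycle through the last two, in which the heterogeneity terms cancel,
determines `δ`. -/
theorem tupleGap_pos {N : ℕ} (hN : 2 ≤ N) {𝔸 : Set (EuclideanSpace ℝ (Fin K))} {𝔹 I : Set ℝ}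
    {ε : ℝ} (hε : 0 < ε) {β₀ : EuclideanSpace ℝ (Fin K)} {δ₀ : ℝ} (hAB : IsCompact (𝔸 ×ˢ 𝔹))
    (hI : IsCompact I) (hδ₀ : δ₀ ∈ 𝔹)
    (hne : ((𝔸 ×ˢ 𝔹) ∩ {θ | ε ≤ dist θ (β₀, δ₀)}).Nonempty)
    {x : Fin (N + 2) → Fin (N + 2) → EuclideanSpace ℝ (Fin K)} {a₀ : Fin (N + 2) → ℝ}
    (ha₀ : ∀ i, a₀ i ∈ I) {J : Finset (Fin N)}
    (hid : IsJointlyIdentified J (fun i j => x (i.castAdd 2) (j.castAdd 2)) (𝔸 ×ˢ 𝔹) I (β₀, δ₀)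
      fun i => a₀ (i.castAdd 2)) :
    0 < tupleGap (𝔸 ×ˢ 𝔹) I ε (β₀, δ₀) x a₀ := by
  have hne' : (Set.univ.pi fun _ : Fin (N + 2) => I).Nonempty := ⟨a₀, fun i _ => ha₀ i⟩
  have hmem := ((isCompact_far (N := N) hAB hI ε (β₀, δ₀)).image
    ((continuous_tupleDiv (N := N) (β₀, δ₀)).comp (Continuous.prodMk_right (x, a₀)))).sInf_mem
    ((hne.prod hne').image _)
  obtain ⟨⟨⟨β, δ⟩, a⟩, ⟨⟨hθ, hfar⟩, ha⟩, hval⟩ := hmem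
  change 0 < sInf _
  refine lt_of_lt_of_eq ?_ hval
  change 0 < tupleDiv (β₀, δ₀) x a₀ (β, δ) a
  refine (tupleDiv_nonneg ..).lt_of_ne fun h0 => ?_
  have hall : ∀ i j : Fin (N + 2), i < j →
      tupleSurplus x (β, δ) a i j = tupleSurplus x (β₀, δ₀) a₀ i j := fun i j hij =>
    eq_of_klLogit_eq_zero ((Finset.sum_eq_zero_iff_of_nonneg fun _ _ => klLogit_nonneg _ _).1
      h0.symm (i, j) (mem_dyads.2 hij))
  have hβ : β = β₀ := by
    have := eq_of_isJointlyIdentified (θ := (β, δ₀)) (a := fun i => a (i.castAdd 2)) hid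
      ⟨hθ.1, hδ₀⟩ (fun i => ha _ trivial) fun g e he => by
        have := hall (e.1.castAdd 2) (e.2.castAdd 2) 
          (Fin.lt_def.2 (Fin.lt_def.1 (mem_dyads.1 he)))
        simp only [tupleSurplus, Fin.val_castAdd, not_le.2 e.1.2, false_and, if_false, zero_mul,
          zero_add] at this
        simp only [surplus]
        linarith
    exact (Prod.ext_iff.1 this).1
  have hδ : δ = δ₀ := by
    subst hβ
    have h1 := hall ⟨0, by omega⟩ ⟨1, by omega⟩ (by simp)
    have h2 := hall ⟨0, by omega⟩ ⟨N, by omega⟩ (by rw [Fin.mk_lt_mk]; omega)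
    have h3 := hall ⟨1, by omega⟩ ⟨N + 1, by omega⟩ (by rw [Fin.mk_lt_mk]; omega)
    have h4 := hall ⟨N, by omega⟩ ⟨N + 1, by omega⟩ (by simp)
    have hN1 : ¬N ≤ 1 := by omega
    have hN0 : ¬N = 0 := by omega
    simp [tupleSurplus, hN1, hN0] at h1 h2 h3 h4
    linarith
  subst hβ hδ
  exact hε.not_ge (hfar.trans_eq (dist_self _))

end Separation

section Probability

variable {Ω : Type*} [MeasurableSpace Ω] {μ : Measure Ω} [IsProbabilityMeasure μ]

theorem tendsto_measure_zero_of_ae_eventually_notMem {S : ℕ → Set Ω}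
    (hS : ∀ k, MeasurableSet (S k)) (h : ∀ᵐ ω ∂μ, ∀ᶠ k in atTop, ω ∉ S k) :
    Tendsto (fun k => μ (S k)) atTop (𝓝 0) := by
  have := tendsto_measure_of_ae_tendsto_indicator_of_isFiniteMeasure (μ := μ) (A := ∅) (As := S)
    atTop MeasurableSet.empty hS (by simpa using h)
  simpa using this

/-- An independent and identically distributed sequence is exchangeable. -/
theorem map_comp_injective_eq {E : Type*} [MeasurableSpace E] {Y : ℕ → Ω → E}
    (hY : ∀ i, Measurable (Y i)) (hindep : iIndepFun Y μ)
    (hdist : ∀ i, IdentDistrib (Y i) (Y 0) μ μ) {k : ℕ} {ι : Fin k → ℕ}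
    (hι : Function.Injective ι) :
    μ.map (fun ω i => Y (ι i) ω) = μ.map (fun ω (i : Fin k) => Y i ω) := by
  have h1 := (iIndepFun_iff_map_fun_eq_pi_map (fun i => (hY (ι i)).aemeasurable)).1
    (hindep.precomp hι)
  have h2 := (iIndepFun_iff_map_fun_eq_pi_map (fun i : Fin k => (hY i).aemeasurable)).1
    (hindep.precomp Fin.val_injective)
  rw [h1, h2]
  congr 1
  funext i
  rw [(hdist (ι i)).map_eq, (hdist i).map_eq]

end Probability

/-! ### Size of the score, and progressions of players -/

section Bounds

variable {n K : ℕ} {J : Finset (Fin n)} {x : Fin n → Fin n → EuclideanSpace ℝ (Fin K)}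
  {θ : EuclideanSpace ℝ (Fin K) × ℝ} {a : Fin n → ℝ}

theorem commonLinks_le {m : ℕ} (hm : J.card ≤ m) (g : SimpleGraph (Fin n)) (i j : Fin n) :
    commonLinks J g i j ≤ m := by
  refine le_trans (Finset.sum_le_card_nsmul J _ 1 fun k _ => ?_) (by simpa using hm)
  rcases link_eq_zero_or_one g i k with h | h <;> rcases link_eq_zero_or_one g j k with h' | h' <;>
    simp [h, h']

theorem abs_surplus_le {m : ℕ} (hm : J.card ≤ m) {B D : ℝ} (hx : ∀ e ∈ dyads n, ‖x e.1 e.2‖ ≤ B)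
    (hβ : ‖θ.1‖ ≤ D) (hδ : |θ.2| ≤ D) (ha : ∀ i, |a i| ≤ D) (g : SimpleGraph (Fin n))
    {e : Fin n × Fin n} (he : e ∈ dyads n) :
    |surplus J x θ a g e.1 e.2| ≤ m * D + B * D + 2 * D := by
  have hB := (norm_nonneg _).trans (hx e he)
  have hC : ((commonLinks J g e.1 e.2 : ℕ) : ℝ) ≤ m := by exact_mod_cast commonLinks_le hm g _ _
  have h1 : |(commonLinks J g e.1 e.2 : ℝ) * θ.2| ≤ m * D := by
    rw [abs_mul, Nat.abs_cast]
    gcongr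
  have h2 : |inner ℝ (x e.1 e.2) θ.1| ≤ B * D :=
    (abs_real_inner_le_norm _ _).trans (mul_le_mul (hx e he) hβ (norm_nonneg _) hB)
  have h3 : |a e.1 + a e.2| ≤ 2 * D := by
    refine (abs_add_le _ _).trans ?_
    linarith [ha e.1, ha e.2]
  unfold surplus
  exact (abs_add_three _ _ _).trans (by linarith)

theorem card_innerDyads_le {m : ℕ} (hm : J.card ≤ m) : (innerDyads J).card ≤ 2 * m * n := by
  have hsub : innerDyads J ⊆ J ×ˢ Finset.univ ∪ Finset.univ ×ˢ J := by
    intro e he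
    simpa using (mem_innerDyads.1 he).2
  refine (Finset.card_le_card hsub).trans ((Finset.card_union_le _ _).trans ?_)
  rw [Finset.card_product, Finset.card_product, Finset.card_univ, Fintype.card_fin]
  nlinarith

/-- The outer dyads that contain the player `i`. -/
def outerDyadsAt (J : Finset (Fin n)) (i : Fin n) : Finset (Fin n × Fin n) :=
  (outerDyads J).filter fun e => e.1 = i ∨ e.2 = i

theorem card_outerDyadsAt_le (i : Fin n) : (outerDyadsAt J i).card ≤ 2 * n := by
  have hsub : outerDyadsAt J i ⊆ {i} ×ˢ Finset.univ ∪ Finset.univ ×ˢ {i} := by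
    intro e he
    have := (Finset.mem_filter.1 he).2
    rw [Finset.mem_union, Finset.mem_product, Finset.mem_product]
    simpa using this
  refine (Finset.card_le_card hsub).trans ((Finset.card_union_le _ _).trans ?_)
  rw [Finset.card_product, Finset.card_product, Finset.card_univ, Fintype.card_fin]
  simp
  omega

theorem card_outerDyads_le : (outerDyads J).card ≤ n ^ 2 := by
  refine (Finset.card_le_univ _).trans ?_
  rw [Fintype.card_prod, Fintype.card_fin, sq]

/-- The size of the residual sums that multiply `δ - δ₀`, `β - β₀` and `a i - a₀ i` in the
log-likelihood difference. -/
noncomputable def scoreNorm (J : Finset (Fin n)) (x : Fin n → Fin n → EuclideanSpace ℝ (Fin K))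
    (θ : EuclideanSpace ℝ (Fin K) × ℝ) (a : Fin n → ℝ) (g : SimpleGraph (Fin n)) : ℝ :=
  ‖∑ e ∈ outerDyads J, linkResid J x θ a g e • (commonLinks J g e.1 e.2 : ℝ)‖ +
    ‖∑ e ∈ outerDyads J, linkResid J x θ a g e • x e.1 e.2‖ +
    ∑ i, ‖∑ e ∈ outerDyadsAt J i, linkResid J x θ a g e • (1 : ℝ)‖

theorem scoreNorm_nonneg (g : SimpleGraph (Fin n)) : 0 ≤ scoreNorm J x θ a g := by
  unfold scoreNorm; positivity

/-- The term linear in the residuals is controlled uniformly in the parameter `(θ', a')`: the outer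
dyads contribute through `scoreNorm`, and the `O(n)` inner dyads are bounded trivially. -/
theorem sum_linkResid_mul_le {m : ℕ} (hm : J.card ≤ m) {θ' : EuclideanSpace ℝ (Fin K) × ℝ}
    {a' : Fin n → ℝ} {g : SimpleGraph (Fin n)} {D M : ℝ} (hβ : ‖θ'.1 - θ.1‖ ≤ D)
    (hδ : |θ'.2 - θ.2| ≤ D) (ha : ∀ i, |a' i - a i| ≤ D)
    (hs : ∀ e ∈ dyads n, |surplus J x θ a g e.1 e.2| ≤ M)
    (hs' : ∀ e ∈ dyads n, |surplus J x θ' a' g e.1 e.2| ≤ M) (hM : 0 ≤ M) :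
    ∑ e ∈ dyads n, linkResid J x θ a g e *
      (surplus J x θ' a' g e.1 e.2 - surplus J x θ a g e.1 e.2) ≤
      D * scoreNorm J x θ a g + 4 * m * M * n := by
  have hinner : ∑ e ∈ innerDyads J, linkResid J x θ a g e *
      (surplus J x θ' a' g e.1 e.2 - surplus J x θ a g e.1 e.2) ≤ 4 * m * M * n := by
    calc _ ≤ ∑ _e ∈ innerDyads J, 2 * M := by
          refine Finset.sum_le_sum fun e he => (le_abs_self _).trans ?_
          have he' : e ∈ dyads n := (Finset.mem_filter.1 he).1
          rw [abs_mul]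
          refine (mul_le_of_le_one_left (abs_nonneg _) (abs_linkResid_le_one g e)).trans ?_
          have := abs_sub (surplus J x θ' a' g e.1 e.2) (surplus J x θ a g e.1 e.2)
          linarith [hs e he', hs' e he']
      _ = (innerDyads J).card * (2 * M) := by rw [Finset.sum_const, nsmul_eq_mul]
      _ ≤ ((2 * m * n : ℕ) : ℝ) * (2 * M) := by
          gcongr
          exact card_innerDyads_le hm
      _ = _ := by push_cast; ring
  have hsplit : ∑ e ∈ outerDyads J, linkResid J x θ a g e *
      (surplus J x θ' a' g e.1 e.2 - surplus J x θ a g e.1 e.2) =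
      (∑ e ∈ outerDyads J, linkResid J x θ a g e • (commonLinks J g e.1 e.2 : ℝ)) *
        (θ'.2 - θ.2) +
      inner ℝ (∑ e ∈ outerDyads J, linkResid J x θ a g e • x e.1 e.2) (θ'.1 - θ.1) +
      ∑ i, (∑ e ∈ outerDyadsAt J i, linkResid J x θ a g e • (1 : ℝ)) * (a' i - a i) := by
    have hu : ∑ i, (∑ e ∈ outerDyadsAt J i, linkResid J x θ a g e • (1 : ℝ)) * (a' i - a i) =
        ∑ e ∈ outerDyads J, linkResid J x θ a g e * ((a' e.1 - a e.1) + (a' e.2 - a e.2)) := by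
      simp only [outerDyadsAt, Finset.sum_filter, Finset.sum_mul]
      rw [Finset.sum_comm]
      refine Finset.sum_congr rfl fun e he => ?_
      have hne := (mem_outerDyads.1 he).1.ne
      have : ∀ i, (if e.1 = i ∨ e.2 = i then linkResid J x θ a g e • (1 : ℝ) else 0) *
          (a' i - a i) = (if e.1 = i then linkResid J x θ a g e * (a' i - a i) else 0) +
          (if e.2 = i then linkResid J x θ a g e * (a' i - a i) else 0) := by
        intro i
        by_cases h1 : e.1 = i
        · have h2 : e.2 ≠ i := fun h2 => hne (h1.trans h2.symm)
          simp [h1, h2]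
        · simp [h1]
      simp only [this, Finset.sum_add_distrib, Finset.sum_ite_eq, Finset.mem_univ, if_true]
      ring
    rw [hu, sum_inner, Finset.sum_mul, ← Finset.sum_add_distrib, ← Finset.sum_add_distrib]
    refine Finset.sum_congr rfl fun e _ => ?_
    rw [real_inner_smul_left, inner_sub_right]
    simp only [surplus, smul_eq_mul]
    ring
  have houter : ∑ e ∈ outerDyads J, linkResid J x θ a g e *
      (surplus J x θ' a' g e.1 e.2 - surplus J x θ a g e.1 e.2) ≤ D * scoreNorm J x θ a g := by
    rw [hsplit, scoreNorm, mul_add, mul_add, Finset.mul_sum]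
    refine add_le_add (add_le_add ?_ ?_) (Finset.sum_le_sum fun i _ => ?_)
    · refine (le_abs_self _).trans ?_
      rw [abs_mul, mul_comm, Real.norm_eq_abs]
      gcongr
    · refine (real_inner_le_norm _ _).trans ?_
      rw [mul_comm]
      gcongr
    · refine (le_abs_self _).trans ?_
      rw [abs_mul, mul_comm, Real.norm_eq_abs]
      gcongr
      exact ha i
  rw [← sum_outer_add_sum_inner (J := J)]
  exact add_le_add houter hinner

theorem scoreNorm_le {m : ℕ} (hm : J.card ≤ m) {B : ℝ}
    (hx : ∀ e ∈ dyads n, ‖x e.1 e.2‖ ≤ B) (g : SimpleGraph (Fin n)) :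
    scoreNorm J x θ a g ≤ (outerDyads J).card * m + (outerDyads J).card * B +
      ∑ i, ((outerDyadsAt J i).card : ℝ) := by
  have key : ∀ {V : Type} [NormedAddCommGroup V] [NormedSpace ℝ V] (T : Finset (Fin n × Fin n))
      (v : Fin n × Fin n → V) (C : ℝ), (∀ e ∈ T, ‖v e‖ ≤ C) →
      ‖∑ e ∈ T, linkResid J x θ a g e • v e‖ ≤ T.card * C := by
    intro V _ _ T v C hv
    rw [← nsmul_eq_mul]
    refine norm_sum_le_of_le _ (fun e he => ?_) |>.trans_eq (Finset.sum_const C)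
    rw [norm_smul]
    exact (mul_le_of_le_one_left (norm_nonneg _) (abs_linkResid_le_one g e)).trans (hv e he)
  unfold scoreNorm
  refine add_le_add (add_le_add (key _ _ _ fun e _ => ?_)
    (key _ _ _ fun e he => hx e (outerDyads_subset he))) (Finset.sum_le_sum fun i _ => ?_)
  · rw [Real.norm_natCast]
    exact_mod_cast commonLinks_le hm g _ _
  · simpa using key (outerDyadsAt J i) (fun _ => (1 : ℝ)) 1 (by simp)

open scoped Classical in
/-- The expected score is of order `n ^ (3 / 2)`, the largest part coming from the `n` sums of
residuals that multiply the individual heterogeneity terms. -/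
theorem sum_likelihood_mul_scoreNorm_le {m : ℕ} (hm : J.card ≤ m) {B : ℝ} (hB : 0 ≤ B)
    (hx : ∀ e ∈ dyads n, ‖x e.1 e.2‖ ≤ B) (hP : ∑ g, likelihood J x θ a g = 1) :
    ∑ g, likelihood J x θ a g * scoreNorm J x θ a g ≤ (m + B + 2) * (n * Real.sqrt n) := by
  have hsq : Real.sqrt (outerDyads J).card ≤ n := by
    rw [Real.sqrt_le_left (Nat.cast_nonneg _)]
    exact_mod_cast card_outerDyads_le
  have hn : (n : ℝ) ≤ n * Real.sqrt n := by
    rcases Nat.eq_zero_or_pos n with rfl | h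
    · simp
    · refine le_mul_of_one_le_right (Nat.cast_nonneg _) ?_
      rw [Real.one_le_sqrt]
      exact_mod_cast h
  have h1 := sum_likelihood_mul_norm_le hP (subset_refl (outerDyads J))
    (v := fun g e => (commonLinks J g e.1 e.2 : ℝ)) (D := m) (Nat.cast_nonneg _)
    (fun e he e' g => by rw [commonLinks_toggle_outer he]) (fun g e _ => by
      rw [Real.norm_natCast]; exact_mod_cast commonLinks_le hm g _ _)
  have h2 := sum_likelihood_mul_norm_le hP (subset_refl (outerDyads J))
    (v := fun _ e => x e.1 e.2) hB (fun _ _ _ _ => rfl)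
    (fun g e he => hx e (outerDyads_subset he))
  have h3 : ∀ i, ∑ g, likelihood J x θ a g *
      ‖∑ e ∈ outerDyadsAt J i, linkResid J x θ a g e • (1 : ℝ)‖ ≤ 2 * Real.sqrt n := by
    intro i
    refine (sum_likelihood_mul_norm_le hP (Finset.filter_subset _ _) (v := fun _ _ => (1 : ℝ))
      zero_le_one (fun _ _ _ _ => rfl) (by simp)).trans ?_
    rw [mul_one, Real.sqrt_le_left (by positivity), mul_pow, Real.sq_sqrt (Nat.cast_nonneg _)]
    have : ((outerDyadsAt J i).card : ℝ) ≤ 2 * n := by exact_mod_cast card_outerDyadsAt_le i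
    exact this.trans (by linarith [(Nat.cast_nonneg n : (0 : ℝ) ≤ n)])
  simp only [scoreNorm, mul_add, Finset.sum_add_distrib, Finset.mul_sum]
  rw [Finset.sum_comm (s := (Finset.univ : Finset (SimpleGraph (Fin n))))]
  have h4 := Finset.sum_le_sum fun i (_ : i ∈ Finset.univ) => h3 i
  rw [Finset.sum_const, Finset.card_univ, Fintype.card_fin, nsmul_eq_mul] at h4
  have h5 : Real.sqrt (outerDyads J).card * m ≤ n * Real.sqrt n * m := by gcongr; linarith
  have h6 : Real.sqrt (outerDyads J).card * B ≤ n * Real.sqrt n * B := by gcongr; linarith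
  linarith

end Bounds

section Progressions

variable {n R N q : ℕ}

/-- The player in position `b` of the `r`-th block in the arithmetic progression of players with
first term `p.1` and common difference `p.2 + 1`, the progression being cut into `R` blocks of
length `N`. -/
def prog (h : R * N * q ≤ n) (p : Fin q × Fin q) (r : Fin R) (b : Fin N) : Fin n :=
  ⟨p.1 + finProdFinEquiv (r, b) * (p.2 + 1), by
    have h1 := p.1.2
    have h2 : (p.2 : ℕ) + 1 ≤ q := p.2.2
    have h3 : (finProdFinEquiv (r, b) : ℕ) + 1 ≤ R * N := (finProdFinEquiv (r, b)).2
    have h4 := Nat.mul_le_mul_left (finProdFinEquiv (r, b) : ℕ) h2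
    have h5 := Nat.mul_le_mul_right q h3
    rw [add_mul, one_mul] at h5
    omega⟩

theorem prog_lt_prog (h : R * N * q ≤ n) (p : Fin q × Fin q) (r : Fin R) {b b' : Fin N}
    (hb : b < b') : prog h p r b < prog h p r b' := by
  rw [Fin.lt_def]
  simp only [prog, finProdFinEquiv_apply_val]
  have : (b : ℕ) < b' := hb
  gcongr

theorem prog_injective (h : R * N * q ≤ n) (p : Fin q × Fin q) {r r' : Fin R} {b b' : Fin N}
    (he : prog h p r b = prog h p r' b') : r = r' ∧ b = b' := by
  have h1 := Fin.ext_iff.1 he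
  simp only [prog] at h1
  have h2 := Nat.eq_of_mul_eq_mul_right (Nat.succ_pos _) (Nat.add_left_cancel h1)
  have h3 := finProdFinEquiv.injective (Fin.ext h2)
  exact Prod.ext_iff.1 h3

/-- Two terms in fixed positions determine an arithmetic progression. -/
theorem prog_pair_injective (h : R * N * q ≤ n) (r : Fin R) {b b' : Fin N} (hb : b < b') :
    Function.Injective fun p : Fin q × Fin q => (prog h p r b, prog h p r b') := by
  intro p p' hpp
  obtain ⟨h1, h2⟩ := Prod.ext_iff.1 hpp
  have h1 := Fin.ext_iff.1 h1
  have h2 := Fin.ext_iff.1 h2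
  simp only [prog, finProdFinEquiv_apply_val] at h1 h2
  have hb' : (b : ℕ) < b' := hb
  obtain ⟨d, hd⟩ := Nat.exists_eq_add_of_lt hb'
  have h3 : (d + 1) * ((p.2 : ℕ) + 1) = (d + 1) * ((p'.2 : ℕ) + 1) := by
    rw [hd] at h2
    zify at h1 h2 ⊢
    linear_combination h2 - h1
  have h4 := Nat.add_right_cancel (Nat.eq_of_mul_eq_mul_left (Nat.succ_pos d) h3)
  rw [h4] at h1
  exact Prod.ext (Fin.ext (Nat.add_right_cancel h1)) (Fin.ext h4)

/-- Summing a function of pairs over the blocks of all progressions counts each pair at most once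
for every block and every two positions in the block. -/
theorem sum_prog_le (h : R * N * q ≤ n) {f : Fin n × Fin n → ℝ} (hf : ∀ e, 0 ≤ f e) :
    ∑ p : Fin q × Fin q, ∑ r : Fin R, ∑ e ∈ dyads N, f (prog h p r e.1, prog h p r e.2) ≤
      (R * N ^ 2 : ℕ) * ∑ e ∈ dyads n, f e := by
  rw [Finset.sum_comm]
  have key : ∀ r : Fin R, ∀ e ∈ dyads N,
      ∑ p : Fin q × Fin q, f (prog h p r e.1, prog h p r e.2) ≤ ∑ e ∈ dyads n, f e := by
    intro r e he
    have hlt := mem_dyads.1 he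
    rw [← Finset.sum_image (f := f) (s := Finset.univ)
      (g := fun p => (prog h p r e.1, prog h p r e.2)) (prog_pair_injective h r hlt).injOn]
    refine Finset.sum_le_sum_of_subset_of_nonneg ?_ fun e _ _ => hf e
    intro e' he'
    obtain ⟨p, -, rfl⟩ := Finset.mem_image.1 he'
    exact mem_dyads.2 (prog_lt_prog h p r hlt)
  have hS : 0 ≤ ∑ e ∈ dyads n, f e := Finset.sum_nonneg fun e _ => hf e
  calc _ ≤ ∑ _r : Fin R, ∑ _e ∈ dyads N, ∑ e ∈ dyads n, f e := by
        refine Finset.sum_le_sum fun r _ => ?_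
        rw [Finset.sum_comm]
        exact Finset.sum_le_sum fun e he => key r e he
    _ = R * ((dyads N).card * ∑ e ∈ dyads n, f e) := by
        simp [Finset.sum_const, nsmul_eq_mul]
    _ ≤ R * (((N ^ 2 : ℕ) : ℝ) * ∑ e ∈ dyads n, f e) := by
        gcongr
        refine (Finset.card_le_univ _).trans ?_
        rw [Fintype.card_prod, Fintype.card_fin, sq]
    _ = _ := by push_cast; ring

/-- The progressions that avoid `J`. -/
def avoiding (h : R * N * q ≤ n) (J : Finset (Fin n)) : Finset (Fin q × Fin q) :=
  Finset.univ.filter fun p => ∀ r b, prog h p r b ∉ J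

theorem le_card_avoiding (h : R * N * q ≤ n) {J : Finset (Fin n)} {m : ℕ} (hm : J.card ≤ m) :
    q ^ 2 ≤ (avoiding h J).card + R * N * m * q := by
  have hsub : Finset.univ.filter (fun p => ¬∀ r b, prog h p r b ∉ J) ⊆
      (Finset.univ ×ˢ J : Finset ((Fin R × Fin N) × Fin n)).biUnion fun s =>
        Finset.univ.filter fun p => prog h p s.1.1 s.1.2 = s.2 := by
    intro p hp
    simp only [Finset.mem_filter, Finset.mem_univ, true_and, not_forall, not_not] at hp
    obtain ⟨r, b, hrb⟩ := hp
    simp only [Finset.mem_biUnion, Finset.mem_product, Finset.mem_univ, true_and,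
      Finset.mem_filter]
    exact ⟨((r, b), prog h p r b), hrb, rfl⟩
  have hone : ∀ s : (Fin R × Fin N) × Fin n,
      (Finset.univ.filter fun p => prog h p s.1.1 s.1.2 = s.2).card ≤ q := by
    intro s
    refine (Finset.card_le_card_of_injOn Prod.snd (t := Finset.univ) (by simp) ?_).trans_eq
      (by simp)
    intro p hp p' hp' h2
    simp only [Finset.coe_filter, Finset.mem_univ, true_and, Set.mem_ofPred_eq] at hp hp'
    have h1 := Fin.ext_iff.1 (hp.trans hp'.symm)
    simp only [prog] at h1
    rw [h2] at h1
    exact Prod.ext (Fin.ext (Nat.add_right_cancel h1)) h2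
  have hcount := (Finset.card_le_card hsub).trans (Finset.card_biUnion_le_card_mul _ _ q
    fun s _ => hone s)
  rw [Finset.card_product, Finset.card_univ, Fintype.card_prod, Fintype.card_fin,
    Fintype.card_fin] at hcount
  have htot := Finset.card_filter_add_card_filter_not (s := (Finset.univ : Finset (Fin q × Fin q)))
    (fun p => ∀ r b, prog h p r b ∉ J)
  rw [Finset.card_univ, Fintype.card_prod, Fintype.card_fin] at htot
  have hm' : R * N * J.card * q ≤ R * N * m * q := by gcongr
  rw [avoiding, sq]
  omega

end Progressions

/-! ### Tuples along arithmetic progressions -/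

section Tuples

variable {n K : ℕ} {J : Finset (Fin n)} {x : Fin n → Fin n → EuclideanSpace ℝ (Fin K)}
  {R N q m : ℕ} {Θ : Set (EuclideanSpace ℝ (Fin K) × ℝ)} {I : Set ℝ} {ε κ : ℝ}
  {θ₀ : EuclideanSpace ℝ (Fin K) × ℝ} {a₀ : Fin n → ℝ}

/-- The pairs formed by a player of the `r`-th block of a progression and a member of `J`. -/
def blockLinks (h : R * N * q ≤ n) (J : Finset (Fin n)) (p : Fin q × Fin q) (r : Fin R) :
    Finset (Fin n × Fin n) :=
  Finset.univ.image (prog h p r) ×ˢ J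

theorem card_blockLinks_le (h : R * N * q ≤ n) (hm : J.card ≤ m) (p : Fin q × Fin q) (r : Fin R) :
    (blockLinks h J p r).card ≤ N * m := by
  rw [blockLinks, Finset.card_product]
  refine Nat.mul_le_mul (Finset.card_image_le.trans_eq (by simp)) hm

theorem disjoint_blockLinks (h : R * N * q ≤ n) (p : Fin q × Fin q) {r r' : Fin R} (hr : r ≠ r') :
    Disjoint (blockLinks h J p r) (blockLinks h J p r') := by
  refine Finset.disjoint_product.2 (Or.inl (Finset.disjoint_left.2 fun i hi hi' => ?_))
  obtain ⟨b, -, rfl⟩ := Finset.mem_image.1 hi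
  obtain ⟨b', -, hb'⟩ := Finset.mem_image.1 hi'
  exact hr (prog_injective h p hb').1.symm

open scoped Classical in
/-- The prescribed links with `J`: the last two players of each block are linked to `k₀` only, the
other players of the block to no member of `J`. -/
noncomputable def blockPattern (h : R * (N + 2) * q ≤ n) (k₀ : Fin n) (p : Fin q × Fin q)
    (e : Fin n × Fin n) : ℕ :=
  if e.2 = k₀ ∧ ∃ r b, e.1 = prog h p r b ∧ N ≤ (b : ℕ) then 1 else 0

theorem blockPattern_eq_zero_or_one (h : R * (N + 2) * q ≤ n) (k₀ : Fin n) (p : Fin q × Fin q)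
    (e : Fin n × Fin n) : blockPattern h k₀ p e = 0 ∨ blockPattern h k₀ p e = 1 := by
  unfold blockPattern; split_ifs <;> simp

theorem blockPattern_prog (h : R * (N + 2) * q ≤ n) (k₀ k : Fin n) (p : Fin q × Fin q)
    (r : Fin R) (b : Fin (N + 2)) :
    blockPattern h k₀ p (prog h p r b, k) = if k = k₀ ∧ N ≤ (b : ℕ) then 1 else 0 := by
  classical
  unfold blockPattern
  refine if_congr (and_congr_right fun _ => ⟨?_, fun hb => ⟨r, b, rfl, hb⟩⟩) rfl rfl
  rintro ⟨r', b', he, hb⟩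
  rwa [(prog_injective h p he).2]

open scoped Classical in
/-- The indicator that the players of the `r`-th block of a progression separate `θ₀` from the
distant parameters by at least `κ`. -/
noncomputable def gapInd (h : R * (N + 2) * q ≤ n) (Θ : Set (EuclideanSpace ℝ (Fin K) × ℝ))
    (I : Set ℝ) (ε κ : ℝ) (θ₀ : EuclideanSpace ℝ (Fin K) × ℝ)
    (x : Fin n → Fin n → EuclideanSpace ℝ (Fin K)) (a₀ : Fin n → ℝ) (p : Fin q × Fin q)
    (r : Fin R) : ℝ :=
  if κ ≤ tupleGap Θ I ε θ₀ (fun i j => x (prog h p r i) (prog h p r j))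
    (fun i => a₀ (prog h p r i)) then 1 else 0

theorem gapInd_nonneg (h : R * (N + 2) * q ≤ n) (p : Fin q × Fin q) (r : Fin R) :
    0 ≤ gapInd h Θ I ε κ θ₀ x a₀ p r := by
  unfold gapInd; split_ifs <;> simp

theorem gapInd_le_one (h : R * (N + 2) * q ≤ n) (p : Fin q × Fin q) (r : Fin R) :
    gapInd h Θ I ε κ θ₀ x a₀ p r ≤ 1 := by
  unfold gapInd; split_ifs <;> simp

/-- The indicator that no block of a progression both separates the parameters and has the
prescribed links with `J`. -/
noncomputable def missInd (h : R * (N + 2) * q ≤ n) (J : Finset (Fin n))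
    (Θ : Set (EuclideanSpace ℝ (Fin K) × ℝ)) (I : Set ℝ) (ε κ : ℝ)
    (θ₀ : EuclideanSpace ℝ (Fin K) × ℝ) (x : Fin n → Fin n → EuclideanSpace ℝ (Fin K))
    (a₀ : Fin n → ℝ) (k₀ : Fin n) (p : Fin q × Fin q) (g : SimpleGraph (Fin n)) : ℝ :=
  ∏ r : Fin R, (1 - gapInd h Θ I ε κ θ₀ x a₀ p r *
    patternInd (blockLinks h J p r) (blockPattern h k₀ p) g)

theorem missInd_nonneg (h : R * (N + 2) * q ≤ n) (k₀ : Fin n) (p : Fin q × Fin q)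
    (g : SimpleGraph (Fin n)) : 0 ≤ missInd h J Θ I ε κ θ₀ x a₀ k₀ p g :=
  Finset.prod_nonneg fun _ _ => sub_nonneg.2
    (mul_le_one₀ (gapInd_le_one ..) (patternInd_nonneg ..) (patternInd_le_one ..))

theorem missInd_le_one (h : R * (N + 2) * q ≤ n) (k₀ : Fin n) (p : Fin q × Fin q)
    (g : SimpleGraph (Fin n)) : missInd h J Θ I ε κ θ₀ x a₀ k₀ p g ≤ 1 :=
  Finset.prod_le_one (fun _ _ => sub_nonneg.2
    (mul_le_one₀ (gapInd_le_one ..) (patternInd_nonneg ..) (patternInd_le_one ..)))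
    fun _ _ => sub_le_self _ (mul_nonneg (gapInd_nonneg ..) (patternInd_nonneg ..))

/-- If a block has the prescribed links with `J`, the surpluses of its pairs are those of the tuple
considered in `tupleSurplus`. -/
theorem surplus_prog (h : R * (N + 2) * q ≤ n) {k₀ : Fin n} (hk₀ : k₀ ∈ J) {p : Fin q × Fin q}
    {r : Fin R} {g : SimpleGraph (Fin n)}
    (hpat : patternInd (blockLinks h J p r) (blockPattern h k₀ p) g ≠ 0)
    (θ : EuclideanSpace ℝ (Fin K) × ℝ) (a : Fin n → ℝ) (i j : Fin (N + 2)) :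
    surplus J x θ a g (prog h p r i) (prog h p r j) =
      tupleSurplus (fun i j => x (prog h p r i) (prog h p r j)) θ (fun i => a (prog h p r i))
        i j := by
  have hlink : ∀ (b : Fin (N + 2)), ∀ k ∈ J,
      link g (prog h p r b) k = if k = k₀ ∧ N ≤ (b : ℕ) then 1 else 0 := by
    intro b k hk
    rw [← blockPattern_prog h k₀ k p r b]
    exact patternInd_eq_one_of_ne_zero (p := (prog h p r b, k)) hpat
      (Finset.mem_product.2 ⟨Finset.mem_image_of_mem _ (Finset.mem_univ _), hk⟩)
  have hC : commonLinks J g (prog h p r i) (prog h p r j) =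
      if N ≤ (i : ℕ) ∧ N ≤ (j : ℕ) then 1 else 0 := by
    unfold commonLinks
    rw [Finset.sum_eq_single_of_mem k₀ hk₀, hlink i k₀ hk₀, hlink j k₀ hk₀]
    · by_cases h1 : N ≤ (i : ℕ) <;> by_cases h2 : N ≤ (j : ℕ) <;> simp [h1, h2]
    · intro k hk hne
      simp [hlink i k hk, hne]
  unfold surplus tupleSurplus
  rw [hC]
  push_cast
  rfl

/-- A progression that does not miss the configuration contributes at least `κ` to the sum of the
divergences. -/
theorem mul_one_sub_missInd_le (h : R * (N + 2) * q ≤ n) (hκ : 0 ≤ κ) {k₀ : Fin n} (hk₀ : k₀ ∈ J)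
    (p : Fin q × Fin q) (g : SimpleGraph (Fin n)) {θ : EuclideanSpace ℝ (Fin K) × ℝ}
    {a : Fin n → ℝ} (hθ : θ ∈ Θ) (hε : ε ≤ dist θ θ₀) (ha : ∀ i, a i ∈ I) :
    κ * (1 - missInd h J Θ I ε κ θ₀ x a₀ k₀ p g) ≤
      ∑ r : Fin R, ∑ e ∈ dyads (N + 2),
        klLogit (surplus J x θ₀ a₀ g (prog h p r e.1) (prog h p r e.2))
          (surplus J x θ a g (prog h p r e.1) (prog h p r e.2)) := by
  have hnn : ∀ r : Fin R, 0 ≤ ∑ e ∈ dyads (N + 2),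
        klLogit (surplus J x θ₀ a₀ g (prog h p r e.1) (prog h p r e.2))
          (surplus J x θ a g (prog h p r e.1) (prog h p r e.2)) := fun r =>
    Finset.sum_nonneg fun _ _ => klLogit_nonneg _ _
  by_cases hall : ∀ r, gapInd h Θ I ε κ θ₀ x a₀ p r *
      patternInd (blockLinks h J p r) (blockPattern h k₀ p) g = 0
  · have h1 : missInd h J Θ I ε κ θ₀ x a₀ k₀ p g = 1 :=
      Finset.prod_eq_one fun r _ => by rw [hall r, sub_zero]
    rw [h1, sub_self, mul_zero]
    exact Finset.sum_nonneg fun r _ => hnn r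
  · push Not at hall
    obtain ⟨r, hr⟩ := hall
    have hgap : κ ≤ tupleGap Θ I ε θ₀ (fun i j => x (prog h p r i) (prog h p r j))
        (fun i => a₀ (prog h p r i)) := by
      by_contra hlt
      exact left_ne_zero_of_mul hr (if_neg hlt)
    calc _ ≤ κ := mul_le_of_le_one_right hκ (sub_le_self _ (missInd_nonneg ..))
      _ ≤ _ := hgap.trans (tupleGap_le _ _ (a := fun i => a (prog h p r i)) hθ hε fun i => ha _)
      _ = ∑ e ∈ dyads (N + 2), klLogit (surplus J x θ₀ a₀ g (prog h p r e.1) (prog h p r e.2))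
          (surplus J x θ a g (prog h p r e.1) (prog h p r e.2)) := by
          refine Finset.sum_congr rfl fun e _ => ?_
          rw [surplus_prog h hk₀ (right_ne_zero_of_mul hr),
            surplus_prog h hk₀ (right_ne_zero_of_mul hr)]
      _ ≤ _ := Finset.single_le_sum (f := fun r => ∑ e ∈ dyads (N + 2),
          klLogit (surplus J x θ₀ a₀ g (prog h p r e.1) (prog h p r e.2))
          (surplus J x θ a g (prog h p r e.1) (prog h p r e.2))) (fun r _ => hnn r)
          (Finset.mem_univ r)

/-- If a joint maximum likelihood estimate is far from `θ₀`, then either many progressions miss the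
separating configuration, or the score is of order `n ^ 2`. -/
theorem gap_le_of_isJML (h : R * (N + 2) * q ≤ n) (hκ : 0 ≤ κ) (hm : J.card ≤ m) {k₀ : Fin n}
    (hk₀ : k₀ ∈ J) {g : SimpleGraph (Fin n)} {θ : EuclideanSpace ℝ (Fin K) × ℝ} {a : Fin n → ℝ}
    {B D : ℝ} (hx : ∀ e ∈ dyads n, ‖x e.1 e.2‖ ≤ B) (hB : 0 ≤ B) (hD : 0 ≤ D)
    (hΘ : ∀ θ ∈ Θ, ‖θ.1‖ ≤ D ∧ |θ.2| ≤ D) (hI : ∀ t ∈ I, |t| ≤ D)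
    (hθ₀ : θ₀ ∈ Θ) (ha₀ : ∀ i, a₀ i ∈ I) (hjml : IsJML J x g Θ I θ a) (hε : ε ≤ dist θ θ₀) :
    κ * ((q : ℝ) ^ 2 - R * (N + 2) * m * q -
      ∑ p ∈ avoiding h J, missInd h J Θ I ε κ θ₀ x a₀ k₀ p g) ≤
      R * (N + 2) ^ 2 * (2 * D * scoreNorm J x θ₀ a₀ g +
        4 * m * (m * D + B * D + 2 * D) * n) := by
  obtain ⟨hθ, ha, hmax⟩ := hjml
  have hbound : ∀ θ' ∈ Θ, ∀ a' : Fin n → ℝ, (∀ i, a' i ∈ I) → ∀ e ∈ dyads n,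
      |surplus J x θ' a' g e.1 e.2| ≤ m * D + B * D + 2 * D := fun θ' hθ' a' ha' e he =>
    abs_surplus_le hm hx (hΘ _ hθ').1 (hΘ _ hθ').2 (fun i => hI _ (ha' i)) g he
  have hkl : ∑ e ∈ dyads n, klLogit (surplus J x θ₀ a₀ g e.1 e.2) (surplus J x θ a g e.1 e.2) ≤
      2 * D * scoreNorm J x θ₀ a₀ g + 4 * m * (m * D + B * D + 2 * D) * n := by
    have h1 := logLik_sub_logLik (J := J) (x := x) (θ := θ₀) (a := a₀) g θ a
    have h2 := hmax θ₀ hθ₀ a₀ ha₀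
    have h3 := sum_linkResid_mul_le (J := J) (x := x) (θ := θ₀) (a := a₀) (θ' := θ) (a' := a)
      (g := g) (D := 2 * D) hm
      ((norm_sub_le _ _).trans (by linarith [(hΘ _ hθ).1, (hΘ _ hθ₀).1]))
      ((abs_sub _ _).trans (by linarith [(hΘ _ hθ).2, (hΘ _ hθ₀).2]))
      (fun i => (abs_sub _ _).trans (by linarith [hI _ (ha i), hI _ (ha₀ i)]))
      (hbound _ hθ₀ _ ha₀) (hbound _ hθ _ ha) (by positivity)
    linarith
  have hcard : (q : ℝ) ^ 2 - R * (N + 2) * m * q ≤ (avoiding h J).card := by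
    have : ((q ^ 2 : ℕ) : ℝ) ≤ _ := Nat.cast_le.2 (le_card_avoiding h hm)
    push_cast at this
    linarith
  calc _ ≤ κ * ((avoiding h J).card -
        ∑ p ∈ avoiding h J, missInd h J Θ I ε κ θ₀ x a₀ k₀ p g) := by gcongr
    _ = ∑ p ∈ avoiding h J, κ * (1 - missInd h J Θ I ε κ θ₀ x a₀ k₀ p g) := by
        rw [← Finset.mul_sum, Finset.sum_sub_distrib, Finset.sum_const, nsmul_eq_mul, mul_one]
    _ ≤ ∑ p ∈ avoiding h J, ∑ r : Fin R, ∑ e ∈ dyads (N + 2),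
        klLogit (surplus J x θ₀ a₀ g (prog h p r e.1) (prog h p r e.2))
          (surplus J x θ a g (prog h p r e.1) (prog h p r e.2)) :=
        Finset.sum_le_sum fun p _ => mul_one_sub_missInd_le h hκ hk₀ p g hθ hε ha
    _ ≤ ∑ p : Fin q × Fin q, ∑ r : Fin R, ∑ e ∈ dyads (N + 2),
        klLogit (surplus J x θ₀ a₀ g (prog h p r e.1) (prog h p r e.2))
          (surplus J x θ a g (prog h p r e.1) (prog h p r e.2)) :=
        Finset.sum_le_sum_of_subset_of_nonneg (Finset.subset_univ _) fun p _ _ =>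
          Finset.sum_nonneg fun _ _ => Finset.sum_nonneg fun _ _ => klLogit_nonneg _ _
    _ ≤ _ := sum_prog_le h
        (f := fun e => klLogit (surplus J x θ₀ a₀ g e.1 e.2) (surplus J x θ a g e.1 e.2))
        fun _ => klLogit_nonneg _ _
    _ ≤ _ := by
        push_cast
        gcongr

/-- Either at least half of the `w r` equal one, which bounds the product, or the proportion of zeros
is at least one half, which makes the right-hand side at least one. -/
theorem prod_one_sub_mul_le {R' : ℕ} (hR' : 0 < R') {c : ℝ} (hc0 : 0 ≤ c) (hc1 : c ≤ 1)
    {w : Fin (2 * R') → ℝ} (hw : ∀ r, w r = 0 ∨ w r = 1) :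
    ∏ r, (1 - c * w r) ≤ (1 - c) ^ R' + 1 / R' * ∑ r, (1 - w r) := by
  have hR : (0 : ℝ) < R' := Nat.cast_pos.2 hR'
  have hprod : ∏ r, (1 - c * w r) = (1 - c) ^ (Finset.univ.filter fun r => w r = 1).card := by
    rw [← Finset.prod_const, Finset.prod_filter]
    refine Finset.prod_congr rfl fun r _ => ?_
    rcases hw r with h | h <;> simp [h]
  have hsum : ∑ r, (1 - w r) = ((Finset.univ.filter fun r => ¬w r = 1).card : ℝ) := by
    rw [Finset.card_filter, Nat.cast_sum]
    refine Finset.sum_congr rfl fun r _ => ?_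
    rcases hw r with h | h <;> simp [h]
  have htot := Finset.card_filter_add_card_filter_not (s := (Finset.univ : Finset (Fin (2 * R'))))
    (fun r => w r = 1)
  rw [Finset.card_univ, Fintype.card_fin] at htot
  rw [hprod, hsum]
  have h1c : 0 ≤ 1 - c := by linarith
  rcases le_or_gt R' (Finset.univ.filter fun r => w r = 1).card with hle | hlt
  · exact (pow_le_pow_of_le_one h1c (by linarith) hle).trans (le_add_of_nonneg_right (by positivity))
  · have : (R' : ℝ) ≤ ((Finset.univ.filter fun r => ¬w r = 1).card : ℝ) := by
      exact_mod_cast (by omega)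
    calc _ ≤ (1 : ℝ) := pow_le_one₀ h1c (by linarith)
      _ = 1 / R' * R' := by field_simp
      _ ≤ 1 / R' * ((Finset.univ.filter fun r => ¬w r = 1).card : ℝ) := by gcongr
      _ ≤ _ := le_add_of_nonneg_left (pow_nonneg h1c _)

open scoped Classical in
theorem sum_likelihood_mul_missInd_le {R' : ℕ} (hR' : 0 < R') (h : 2 * R' * (N + 2) * q ≤ n)
    {ρ : ℝ} (hρ : 0 < ρ) (hm : J.card ≤ m) (hρ1 : ρ ≤ 1)
    (hfac : ∀ g, ∀ e ∈ dyads n, ρ ≤ dyadFactor J x θ₀ a₀ g e)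
    (hP : ∑ g, likelihood J x θ₀ a₀ g = 1) (k₀ : Fin n) {p : Fin q × Fin q}
    (hp : p ∈ avoiding h J) :
    ∑ g, likelihood J x θ₀ a₀ g * missInd h J Θ I ε κ θ₀ x a₀ k₀ p g ≤
      (1 - (ρ ^ m / 2) ^ ((N + 2) * m)) ^ R' +
        1 / R' * ∑ r, (1 - gapInd h Θ I ε κ θ₀ x a₀ p r) := by
  have hc1 : ρ ^ m / 2 ≤ 1 := by
    have := pow_le_one₀ hρ.le hρ1 (n := m)
    linarith
  refine (sum_likelihood_mul_prod_le hρ hm hρ1 hfac hP (fun r => card_blockLinks_le h hm p r)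
    ?_ (fun r r' hr => disjoint_blockLinks h p hr) (blockPattern_eq_zero_or_one h k₀ p)
    (fun r => gapInd_nonneg h p r) (fun r => gapInd_le_one h p r) Finset.univ).trans
    (prod_one_sub_mul_le hR' (by positivity) (pow_le_one₀ (by positivity) hc1) fun r => ?_)
  · intro r e he
    obtain ⟨h1, h2⟩ := Finset.mem_product.1 he
    obtain ⟨b, -, hb⟩ := Finset.mem_image.1 h1
    exact ⟨hb ▸ (Finset.mem_filter.1 hp).2 r b, h2⟩
  · unfold gapInd
    split_ifs <;> simp

end Tuples

/-! ### Measurability and conditional expectations -/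

section Measurability

variable {Z : Type*} [MeasurableSpace Z] {n K : ℕ} {J : Finset (Fin n)}
  {x : Z → Fin n → Fin n → EuclideanSpace ℝ (Fin K)} {a : Z → Fin n → ℝ}
  {θ : EuclideanSpace ℝ (Fin K) × ℝ}

theorem measurable_linkResid (hx : ∀ i j, Measurable fun z => x z i j)
    (ha : ∀ i, Measurable fun z => a z i) (g : SimpleGraph (Fin n)) (e : Fin n × Fin n) :
    Measurable fun z => linkResid J (x z) θ (a z) g e := by
  have hs : Measurable fun z => surplus J (x z) θ (a z) g e.1 e.2 := by
    unfold surplus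
    exact (measurable_const.add ((hx _ _).inner measurable_const)).add ((ha _).add (ha _))
  unfold linkResid linkProb
  fun_prop

theorem measurable_scoreNorm (hx : ∀ i j, Measurable fun z => x z i j)
    (ha : ∀ i, Measurable fun z => a z i) (g : SimpleGraph (Fin n)) :
    Measurable fun z => scoreNorm J (x z) θ (a z) g := by
  have hr := fun e => measurable_linkResid (J := J) (θ := θ) hx ha g e
  unfold scoreNorm
  refine Measurable.add (Measurable.add ?_ ?_) (Finset.measurable_fun_sum _ fun i _ => ?_)
  · exact (Finset.measurable_fun_sum _ fun e _ => (hr e).smul measurable_const).norm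
  · exact (Finset.measurable_fun_sum _ fun e _ => (hr e).smul (hx _ _)).norm
  · exact (Finset.measurable_fun_sum _ fun e _ => (hr e).smul measurable_const).norm

theorem measurable_tupleGap {N : ℕ} {Θ : Set (EuclideanSpace ℝ (Fin K) × ℝ)} {I : Set ℝ}
    (hΘ : IsCompact Θ) (hI : IsCompact I) (ε : ℝ)
    {x : Z → Fin (N + 2) → Fin (N + 2) → EuclideanSpace ℝ (Fin K)} {a : Z → Fin (N + 2) → ℝ}
    (hx : ∀ i j, Measurable fun z => x z i j) (ha : ∀ i, Measurable fun z => a z i) :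
    Measurable fun z => tupleGap Θ I ε θ (x z) (a z) := by
  have h1 := (continuous_tupleGap (N := N) hΘ hI ε θ).measurable
  have hx' : Measurable x := measurable_pi_iff.2 fun i => measurable_pi_iff.2 fun j => hx i j
  have ha' : Measurable a := measurable_pi_iff.2 ha
  have h2 := h1.comp (hx'.prodMk ha')
  exact h2

theorem measurable_gapInd {R N q : ℕ} (h : R * (N + 2) * q ≤ n)
    {Θ : Set (EuclideanSpace ℝ (Fin K) × ℝ)} {I : Set ℝ} (hΘ : IsCompact Θ) (hI : IsCompact I)
    (ε κ : ℝ) (hx : ∀ i j, Measurable fun z => x z i j) (ha : ∀ i, Measurable fun z => a z i)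
    (p : Fin q × Fin q) (r : Fin R) :
    Measurable fun z => gapInd h Θ I ε κ θ (x z) (a z) p r := by
  unfold gapInd
  exact Measurable.ite (measurableSet_le measurable_const
    (measurable_tupleGap hΘ hI ε (fun i j => hx _ _) fun i => ha _))
    measurable_const measurable_const

theorem measurable_missInd {R N q : ℕ} (h : R * (N + 2) * q ≤ n)
    {Θ : Set (EuclideanSpace ℝ (Fin K) × ℝ)} {I : Set ℝ} (hΘ : IsCompact Θ) (hI : IsCompact I)
    (ε κ : ℝ) (hx : ∀ i j, Measurable fun z => x z i j) (ha : ∀ i, Measurable fun z => a z i)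
    (k₀ : Fin n) (p : Fin q × Fin q) (g : SimpleGraph (Fin n)) :
    Measurable fun z => missInd h J Θ I ε κ θ (x z) (a z) k₀ p g := by
  unfold missInd
  exact Finset.measurable_fun_prod _ fun r _ => measurable_const.sub
    ((measurable_gapInd h hΘ hI ε κ hx ha p r).mul measurable_const)

end Measurability

section Transfer

variable {Ω γ : Type*} {m mΩ : MeasurableSpace Ω} {μ : Measure Ω} [IsProbabilityMeasure μ]
  {G : Ω → γ} {P : Ω → γ → ℝ}

theorem integrable_indicator_mul (hG : ∀ g, MeasurableSet {ω | G ω = g}) {f : Ω → ℝ}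
    (hf : Measurable f) {C : ℝ} (hC : ∀ᵐ ω ∂μ, |f ω| ≤ C) (g : γ) :
    Integrable ({ω | G ω = g}.indicator (fun _ => (1 : ℝ)) * f) μ := by
  refine (Integrable.of_bound (C := C) hf.aestronglyMeasurable hC).bdd_mul (c := 1)
    (measurable_const.indicator (hG g)).aestronglyMeasurable (ae_of_all _ fun ω => ?_)
  exact (norm_indicator_le_norm_self _ _).trans (by simp)

/-- Conditional probabilities of the values of a finitely valued variable sum to one. -/
theorem ae_sum_condProb_eq_one [Fintype γ] (hm : m ≤ mΩ) (hG : ∀ g, MeasurableSet {ω | G ω = g})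
    (hP : ∀ g, μ[{ω | G ω = g}.indicator (fun _ => (1 : ℝ)) | m] =ᵐ[μ] fun ω => P ω g) :
    ∀ᵐ ω ∂μ, ∑ g, P ω g = 1 := by
  classical
  have hsum : ∑ g, {ω | G ω = g}.indicator (fun _ => (1 : ℝ)) = fun _ => 1 := by
    funext ω
    simp [Finset.sum_apply, Set.indicator_apply]
  have h1 := condExp_finsetSum (μ := μ) (s := Finset.univ)
    (f := fun g => {ω | G ω = g}.indicator (fun _ => (1 : ℝ)))
    (fun g _ => (integrable_const (1 : ℝ)).indicator (hG g)) m
  rw [hsum, condExp_const hm] at h1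
  filter_upwards [h1, ae_all_iff.2 hP] with ω h2 h3
  rw [Finset.sum_apply] at h2
  rw [h2]
  exact Finset.sum_congr rfl fun g _ => (h3 g).symm

/-- The expectation of `f ω (G ω)` is obtained by averaging over the conditional law of `G`. -/
theorem integral_eq_integral_sum_condProb [Fintype γ] (hm : m ≤ mΩ) (hG : ∀ g, MeasurableSet {ω | G ω = g})
    (hP : ∀ g, μ[{ω | G ω = g}.indicator (fun _ => (1 : ℝ)) | m] =ᵐ[μ] fun ω => P ω g)
    {f : Ω → γ → ℝ} (hf : ∀ g, StronglyMeasurable[m] fun ω => f ω g) {C : ℝ}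
    (hC : ∀ᵐ ω ∂μ, ∀ g, |f ω g| ≤ C) :
    Integrable (fun ω => f ω (G ω)) μ ∧ Integrable (fun ω => ∑ g, P ω g * f ω g) μ ∧
      ∫ ω, f ω (G ω) ∂μ = ∫ ω, ∑ g, P ω g * f ω g ∂μ := by
  classical
  set χ : γ → Ω → ℝ := fun g => {ω | G ω = g}.indicator (fun _ => (1 : ℝ)) with hχ
  have hχi : ∀ g, Integrable (χ g) μ := fun g => (integrable_const (1 : ℝ)).indicator (hG g)
  have hint : ∀ g, Integrable (χ g * fun ω => f ω g) μ := fun g =>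
    integrable_indicator_mul hG ((hf g).measurable.mono hm le_rfl)
      (hC.mono fun ω h => h g) g
  have hpull : ∀ g, μ[χ g * fun ω => f ω g | m] =ᵐ[μ] fun ω => P ω g * f ω g := fun g => by
    filter_upwards [condExp_mul_of_stronglyMeasurable_right (hf g) (hint g) (hχi g), hP g]
      with ω h1 h2
    rw [h1, Pi.mul_apply, ← h2]
  have hPi : ∀ g, Integrable (fun ω => P ω g * f ω g) μ := fun g =>
    integrable_condExp.congr (hpull g)
  have hdecomp : (fun ω => f ω (G ω)) = fun ω => ∑ g, (χ g * fun ω => f ω g) ω := by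
    funext ω
    simp [hχ, Set.indicator_apply]
  refine ⟨?_, integrable_finsetSum _ fun g _ => hPi g, ?_⟩
  · rw [hdecomp]
    exact integrable_finsetSum _ fun g _ => hint g
  · rw [hdecomp, integral_finsetSum _ fun g _ => hint g, integral_finsetSum _ fun g _ => hPi g]
    refine Finset.sum_congr rfl fun g _ => ?_
    rw [← integral_condExp hm]
    exact integral_congr_ae (hpull g)

end Transfer

section Consistency

variable {Ω : Type*} [MeasurableSpace Ω] {μ : Measure Ω} [IsProbabilityMeasure μ]
  {𝒳 : Type*} [MeasurableSpace 𝒳] {K : ℕ}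

/-- The separation of `θ₀` by a tuple of `N + 2` players with attributes and heterogeneity terms
`z`. -/
noncomputable def playerGap {N : ℕ} (w : 𝒳 → 𝒳 → EuclideanSpace ℝ (Fin K))
    (Θ : Set (EuclideanSpace ℝ (Fin K) × ℝ)) (I : Set ℝ) (ε : ℝ)
    (θ₀ : EuclideanSpace ℝ (Fin K) × ℝ) (z : Fin (N + 2) → 𝒳 × ℝ) : ℝ :=
  tupleGap Θ I ε θ₀ (fun i j => w (z i).1 (z j).1) fun i => (z i).2

theorem measurable_cov {w : 𝒳 → 𝒳 → EuclideanSpace ℝ (Fin K)}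
    (hw : Measurable (Function.uncurry w)) {n : ℕ} (i j : Fin n) :
    Measurable fun z : Fin n → 𝒳 × ℝ => w (z i).1 (z j).1 :=
  hw.comp ((measurable_pi_apply i).fst.prodMk (measurable_pi_apply j).fst)

theorem measurable_het {n : ℕ} (i : Fin n) :
    Measurable fun z : Fin n → 𝒳 × ℝ => (z i).2 := (measurable_pi_apply i).snd

theorem measurable_playerGap {N : ℕ} {w : 𝒳 → 𝒳 → EuclideanSpace ℝ (Fin K)}
    (hw : Measurable (Function.uncurry w)) {Θ : Set (EuclideanSpace ℝ (Fin K) × ℝ)} {I : Set ℝ}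
    (hΘ : IsCompact Θ) (hI : IsCompact I) (ε : ℝ) (θ₀ : EuclideanSpace ℝ (Fin K) × ℝ) :
    Measurable (playerGap (N := N) w Θ I ε θ₀) :=
  measurable_tupleGap hΘ hI ε (fun i j => measurable_cov hw i j) measurable_het

/-- Sufficiently many players separate `θ₀` from all distant parameters by a fixed amount, with
probability as close to one as desired. -/
theorem exists_measure_playerGap_lt_le {w : 𝒳 → 𝒳 → EuclideanSpace ℝ (Fin K)}
    (hw : Measurable (Function.uncurry w)) {𝔸 : Set (EuclideanSpace ℝ (Fin K))} {𝔹 I : Set ℝ}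
    {β₀ : EuclideanSpace ℝ (Fin K)} {δ₀ : ℝ} {X : ℕ → Ω → 𝒳} {A₀ : ℕ → Ω → ℝ}
    (hX : ∀ i, Measurable (X i)) (hA₀ : ∀ i, Measurable (A₀ i)) {J : (n : ℕ) → Finset (Fin n)}
    (hI : IsCompact I) (hA₀I : ∀ i, ∀ᵐ ω ∂μ, A₀ i ω ∈ I)
    (hident : ∀ᵐ ω ∂μ, ∀ᶠ n : ℕ in atTop,
      IsJointlyIdentified (J n) (dyadCov w (fun i => X i ω) n) (𝔸 ×ˢ 𝔹) I (β₀, δ₀)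
        (fun i : Fin n => A₀ i ω))
    (hAB : IsCompact (𝔸 ×ˢ 𝔹)) (hδ₀ : δ₀ ∈ 𝔹) {ε : ℝ} (hε : 0 < ε)
    (hne : ((𝔸 ×ˢ 𝔹) ∩ {θ | ε ≤ dist θ (β₀, δ₀)}).Nonempty) {η : ℝ} (hη : 0 < η) :
    ∃ (N : ℕ) (κ : ℝ), 0 < κ ∧
      μ.real {ω | playerGap (N := N) w (𝔸 ×ˢ 𝔹) I ε (β₀, δ₀)
        (fun i => (X i ω, A₀ i ω)) < κ} ≤ η := by
  set Γ : (N : ℕ) → Ω → ℝ := fun N ω => playerGap (N := N) w (𝔸 ×ˢ 𝔹) I ε (β₀, δ₀)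
    (fun i => (X i ω, A₀ i ω)) with hΓ
  have hΓm : ∀ N, Measurable (Γ N) := fun N => (measurable_playerGap hw hAB hI ε _).comp
    (measurable_pi_iff.2 fun i => (hX i).prodMk (hA₀ i))
  have hpos : ∀ᵐ ω ∂μ, ∀ᶠ N in atTop, ω ∉ {ω | Γ N ω ≤ 0} := by
    filter_upwards [hident, ae_all_iff.2 hA₀I] with ω h1 h2
    filter_upwards [h1, eventually_ge_atTop 2] with N h3 hN
    exact not_le.2 (tupleGap_pos hN hε hAB hI hδ₀ hne (fun i => h2 i) h3)
  have h1 := tendsto_measure_zero_of_ae_eventually_notMem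
    (fun N => measurableSet_le (hΓm N) measurable_const) hpos
  have hη2 : 0 < ENNReal.ofReal (η / 2) := ENNReal.ofReal_pos.2 (by positivity)
  obtain ⟨N, hN⟩ := (h1.eventually_le_const hη2).exists
  have h2 := tendsto_measure_zero_of_ae_eventually_notMem (μ := μ)
    (S := fun k : ℕ => {ω | 0 < Γ N ω} ∩ {ω | Γ N ω < 1 / ((k : ℝ) + 1)})
    (fun k => (measurableSet_lt measurable_const (hΓm N)).inter
      (measurableSet_lt (hΓm N) measurable_const)) (ae_of_all _ fun ω => by
      rcases le_or_gt (Γ N ω) 0 with h | h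
      · exact Eventually.of_forall fun k hk => absurd hk.1 (not_lt.2 h)
      · filter_upwards [tendsto_one_div_add_atTop_nhds_zero_nat.eventually_le_const h] with k hk
        exact fun h' => absurd h'.2 (not_lt.2 hk))
  obtain ⟨k, hk⟩ := (h2.eventually_le_const hη2).exists
  refine ⟨N, 1 / ((k : ℝ) + 1), by positivity, ?_⟩
  refine ENNReal.toReal_le_of_le_ofReal hη.le ?_
  calc _ ≤ μ ({ω | Γ N ω ≤ 0} ∪ ({ω | 0 < Γ N ω} ∩ {ω | Γ N ω < 1 / ((k : ℝ) + 1)})) := by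
        refine measure_mono fun ω hω => ?_
        rcases le_or_gt (Γ N ω) 0 with h | h
        · exact Or.inl h
        · exact Or.inr ⟨h, hω⟩
    _ ≤ ENNReal.ofReal (η / 2) + ENNReal.ofReal (η / 2) :=
        (measure_union_le _ _).trans (add_le_add hN hk)
    _ = ENNReal.ofReal η := by
        rw [← ENNReal.ofReal_add (by positivity) (by positivity), add_halves]

end Consistency

/-! ### Probability of a distant estimate -/

section Consistency

variable {Ω : Type*} [MeasurableSpace Ω] {μ : Measure Ω} [IsProbabilityMeasure μ]
  {𝒳 : Type*} [MeasurableSpace 𝒳] {K : ℕ}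

/-- By exchangeability, every block of every progression fails to separate `θ₀` with the same
probability as the first `N + 2` players. -/
theorem integral_one_sub_gapInd_le {w : 𝒳 → 𝒳 → EuclideanSpace ℝ (Fin K)}
    (hw : Measurable (Function.uncurry w)) {Θ : Set (EuclideanSpace ℝ (Fin K) × ℝ)} {I : Set ℝ}
    (hΘ : IsCompact Θ) (hI : IsCompact I) {θ₀ : EuclideanSpace ℝ (Fin K) × ℝ}
    {X : ℕ → Ω → 𝒳} {A₀ : ℕ → Ω → ℝ} (hX : ∀ i, Measurable (X i)) (hA₀ : ∀ i, Measurable (A₀ i))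
    (hindep : iIndepFun (fun i ω => (X i ω, A₀ i ω)) μ)
    (hdist : ∀ i, IdentDistrib (fun ω => (X i ω, A₀ i ω)) (fun ω => (X 0 ω, A₀ 0 ω)) μ μ)
    {n N R q : ℕ} (h : R * (N + 2) * q ≤ n) {ε κ η : ℝ}
    (hη : μ.real {ω | playerGap (N := N) w Θ I ε θ₀ (fun i => (X i ω, A₀ i ω)) < κ} ≤ η)
    (p : Fin q × Fin q) (r : Fin R) :
    ∫ ω, (1 - gapInd h Θ I ε κ θ₀ (dyadCov w (fun i => X i ω) n) (fun i => A₀ i ω) p r) ∂μ ≤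
      η := by
  set S : Set (Fin (N + 2) → 𝒳 × ℝ) := {z | playerGap w Θ I ε θ₀ z < κ} with hS
  have hSm : MeasurableSet S :=
    measurableSet_lt (measurable_playerGap hw hΘ hI ε θ₀) measurable_const
  have hY : ∀ i, Measurable fun ω => (X i ω, A₀ i ω) := fun i => (hX i).prodMk (hA₀ i)
  set Y : Ω → Fin (N + 2) → 𝒳 × ℝ := fun ω b =>
    (X (prog h p r b : ℕ) ω, A₀ (prog h p r b : ℕ) ω) with hYdef
  have hYm : Measurable Y := measurable_pi_iff.2 fun b => hY _
  have hY0 : Measurable fun ω (i : Fin (N + 2)) => (X i ω, A₀ i ω) :=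
    measurable_pi_iff.2 fun i => hY i
  have hmap := map_comp_injective_eq (μ := μ) (Y := fun i ω => (X i ω, A₀ i ω)) hY hindep hdist
    (ι := fun b : Fin (N + 2) => (prog h p r b : ℕ))
    (fun b b' hb => (prog_injective h p (Fin.ext hb)).2)
  have hind : (fun ω => 1 - gapInd h Θ I ε κ θ₀ (dyadCov w (fun i => X i ω) n)
      (fun i => A₀ i ω) p r) = (Y ⁻¹' S).indicator fun _ => (1 : ℝ) := by
    funext ω
    have hmem : (ω ∈ Y ⁻¹' S) ↔ ¬κ ≤ tupleGap Θ I ε θ₀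
        (fun i j => dyadCov w (fun i => X i ω) n (prog h p r i) (prog h p r j))
        (fun i => A₀ (prog h p r i) ω) := by
      rw [not_le]
      exact Iff.rfl
    unfold gapInd
    by_cases hω : ω ∈ Y ⁻¹' S
    · rw [Set.indicator_of_mem hω, if_neg (hmem.1 hω), sub_zero]
    · rw [Set.indicator_of_notMem hω, if_pos (not_not.1 fun h' => hω (hmem.2 h')), sub_self]
  rw [hind, integral_indicator_const _ (hYm hSm), smul_eq_mul, mul_one]
  refine le_of_eq_of_le ?_ hη
  have h1 := congrArg (fun ν => ν.real S) hmap
  rw [map_measureReal_apply hYm hSm, map_measureReal_apply hY0 hSm] at h1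
  exact h1

set_option maxHeartbeats 1000000 in
/-- A quantitative form of consistency: if the progressions with `q` first terms and `q` common
differences fit into the `n` players, the probability that the joint maximum likelihood estimate of `θ₀` errs by at least `ε`
is controlled by the probability that a progression misses the separating configuration and by the
expected size of the score. -/
theorem measureReal_dist_jml_le {w : 𝒳 → 𝒳 → EuclideanSpace ℝ (Fin K)}
    (hw : Measurable (Function.uncurry w)) {Θ : Set (EuclideanSpace ℝ (Fin K) × ℝ)} {I : Set ℝ}
    (hΘ : IsCompact Θ) (hI : IsCompact I) {θ₀ : EuclideanSpace ℝ (Fin K) × ℝ} (hθ₀ : θ₀ ∈ Θ)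
    {X : ℕ → Ω → 𝒳} {A₀ : ℕ → Ω → ℝ} (hX : ∀ i, Measurable (X i)) (hA₀ : ∀ i, Measurable (A₀ i))
    (hindep : iIndepFun (fun i ω => (X i ω, A₀ i ω)) μ)
    (hdist : ∀ i, IdentDistrib (fun ω => (X i ω, A₀ i ω)) (fun ω => (X 0 ω, A₀ 0 ω)) μ μ)
    {n m : ℕ} {J : Finset (Fin n)} (hJ : J.card ≤ m) {k₀ : Fin n} (hk₀ : k₀ ∈ J)
    {G : Ω → SimpleGraph (Fin n)} (hG : ∀ g, MeasurableSet {ω | G ω = g})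
    (hlik : ∀ g, μ[Set.indicator {ω | G ω = g} (fun _ => (1 : ℝ)) | playerSigma X A₀ n] =ᵐ[μ]
        fun ω => likelihood J (dyadCov w (fun i => X i ω) n) θ₀ (fun i : Fin n => A₀ i ω) g)
    (hA₀I : ∀ i, ∀ᵐ ω ∂μ, A₀ i ω ∈ I) {B D : ℝ} (hB : 0 ≤ B) (hD : 0 ≤ D)
    (hx : ∀ i j, i ≠ j → ∀ᵐ ω ∂μ, ‖w (X i ω) (X j ω)‖ ≤ B)
    (hΘD : ∀ θ ∈ Θ, ‖θ.1‖ ≤ D ∧ |θ.2| ≤ D) (hID : ∀ t ∈ I, |t| ≤ D)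
    {θJML : Ω → EuclideanSpace ℝ (Fin K) × ℝ} {AJML : Ω → Fin n → ℝ}
    (hJML : ∀ᵐ ω ∂μ, IsJML J (dyadCov w (fun i => X i ω) n) (G ω) Θ I (θJML ω) (AJML ω))
    {N R' q : ℕ} (hR' : 0 < R') (hq : 0 < q) (h : 2 * R' * (N + 2) * q ≤ n) {ε κ η : ℝ}
    (hκ : 0 < κ)
    (hη : μ.real {ω | playerGap (N := N) w Θ I ε θ₀ (fun i => (X i ω, A₀ i ω)) < κ} ≤ η)
    (hsmall : 2 * R' * (N + 2) * m / q + 2 * R' * (N + 2) ^ 2 *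
      (4 * m * (m * D + B * D + 2 * D) * n) / (κ * q ^ 2) ≤ 1 / 2) :
    μ.real {ω | ε ≤ dist (θJML ω) θ₀} ≤
      2 * ((1 - ((1 / (1 + Real.exp (m * D + B * D + 2 * D))) ^ m / 2) ^ ((N + 2) * m)) ^ R' +
        2 * η + 2 * R' * (N + 2) ^ 2 * (2 * D) / (κ * q ^ 2) *
          ((m + B + 2) * (n * Real.sqrt n))) := by
  classical
  set M : ℝ := m * D + B * D + 2 * D with hM
  set ρ : ℝ := 1 / (1 + Real.exp M) with hρ
  have hρ0 : 0 < ρ := by positivity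
  have hρ1 : ρ ≤ 1 := by
    rw [hρ, div_le_one (by positivity)]
    linarith [Real.exp_pos M]
  set c' : ℝ := (1 - (ρ ^ m / 2) ^ ((N + 2) * m)) ^ R' with hc'
  set C : ℝ := 2 * R' * (N + 2) ^ 2 * (2 * D) / (κ * q ^ 2) with hC
  have hq' : (0 : ℝ) < q := Nat.cast_pos.2 hq
  have hR : (0 : ℝ) < R' := Nat.cast_pos.2 hR'
  have hC0 : 0 ≤ C := by positivity
  set cov : Ω → Fin n → Fin n → EuclideanSpace ℝ (Fin K) :=
    fun ω => dyadCov w (fun i => X i ω) n with hcov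
  set het : Ω → Fin n → ℝ := fun ω i => A₀ i ω with hhet
  set miss : Ω → SimpleGraph (Fin n) → Fin q × Fin q → ℝ := fun ω g p =>
    missInd h J Θ I ε κ θ₀ (cov ω) (het ω) k₀ p g with hmiss
  set f : Ω → SimpleGraph (Fin n) → ℝ := fun ω g =>
    1 / (q : ℝ) ^ 2 * ∑ p ∈ avoiding h J, miss ω g p + C * scoreNorm J (cov ω) θ₀ (het ω) g with hf
  have hz : Measurable fun ω (i : Fin n) => (X i ω, A₀ i ω) :=
    measurable_pi_iff.2 fun i => (hX i).prodMk (hA₀ i)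
  have hm : playerSigma X A₀ n ≤ ‹MeasurableSpace Ω› := hz.comap_le
  -- the almost sure bounds on the data
  have hdata : ∀ᵐ ω ∂μ, (∀ i : Fin n, A₀ i ω ∈ I) ∧ ∀ e ∈ dyads n, ‖cov ω e.1 e.2‖ ≤ B := by
    have h1 : ∀ᵐ ω ∂μ, ∀ i, A₀ i ω ∈ I := ae_all_iff.2 hA₀I
    have h2 : ∀ᵐ ω ∂μ, ∀ i j, i ≠ j → ‖w (X i ω) (X j ω)‖ ≤ B := by
      simp only [ae_all_iff]
      exact fun i j hij => hx i j hij
    filter_upwards [h1, h2] with ω h3 h4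
    exact ⟨fun i => h3 i, fun e he => h4 _ _ (Fin.val_ne_of_ne (mem_dyads.1 he).ne)⟩
  have hfm : ∀ g, StronglyMeasurable[playerSigma X A₀ n] fun ω => f ω g := by
    intro g
    have h1 : Measurable fun z : Fin n → 𝒳 × ℝ => 1 / (q : ℝ) ^ 2 * ∑ p ∈ avoiding h J,
        missInd h J Θ I ε κ θ₀ (fun i j => w (z i).1 (z j).1) (fun i => (z i).2) k₀ p g +
        C * scoreNorm J (fun i j => w (z i).1 (z j).1) θ₀ (fun i => (z i).2) g :=
      (measurable_const.mul (Finset.measurable_fun_sum _ fun p _ =>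
        measurable_missInd h hΘ hI ε κ (fun i j => measurable_cov hw i j) measurable_het k₀ p g)).add
        (measurable_const.mul
          (measurable_scoreNorm (fun i j => measurable_cov hw i j) measurable_het g))
    have h2 := h1.comp (comap_measurable fun ω (i : Fin n) => (X i ω, A₀ i ω))
    exact h2.stronglyMeasurable
  have hf0 : ∀ ω g, 0 ≤ f ω g := fun ω g => add_nonneg
    (mul_nonneg (by positivity) (Finset.sum_nonneg fun p _ => missInd_nonneg h k₀ p g))
    (mul_nonneg hC0 (scoreNorm_nonneg g))
  have hfC : ∀ᵐ ω ∂μ, ∀ g, |f ω g| ≤ 1 / (q : ℝ) ^ 2 * (avoiding h J).card +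
      C * ((outerDyads J).card * m + (outerDyads J).card * B +
        ∑ i, ((outerDyadsAt J i).card : ℝ)) := by
    filter_upwards [hdata] with ω hω g
    rw [abs_of_nonneg (hf0 ω g)]
    refine add_le_add (mul_le_mul_of_nonneg_left ?_ (by positivity))
      (mul_le_mul_of_nonneg_left (scoreNorm_le hJ hω.2 g) hC0)
    exact (Finset.sum_le_sum fun p _ => missInd_le_one h k₀ p g).trans_eq (by simp)
  obtain ⟨hint, hint', heq⟩ := integral_eq_integral_sum_condProb hm hG hlik hfm hfC
  have hsum1 := ae_sum_condProb_eq_one hm hG hlik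
  -- the expectation of `f` given attributes and heterogeneity terms
  set bound : Ω → ℝ := fun ω => 1 / (q : ℝ) ^ 2 * ∑ p ∈ avoiding h J, (c' +
      1 / R' * ∑ r, (1 - gapInd h Θ I ε κ θ₀ (cov ω) (het ω) p r)) +
      C * ((m + B + 2) * (n * Real.sqrt n)) with hbound
  have hle : ∀ᵐ ω ∂μ, ∑ g, likelihood J (cov ω) θ₀ (het ω) g * f ω g ≤ bound ω := by
    filter_upwards [hdata, hsum1] with ω h1 h2
    have hfac : ∀ g, ∀ e ∈ dyads n, ρ ≤ dyadFactor J (cov ω) θ₀ (het ω) g e := fun g e he =>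
      le_dyadFactor (abs_surplus_le hJ h1.2 (hΘD _ hθ₀).1 (hΘD _ hθ₀).2
        (fun i => hID _ (h1.1 i)) g he)
    have hexp : ∑ g, likelihood J (cov ω) θ₀ (het ω) g * f ω g = 1 / (q : ℝ) ^ 2 *
        ∑ p ∈ avoiding h J, ∑ g, likelihood J (cov ω) θ₀ (het ω) g * miss ω g p +
        C * ∑ g, likelihood J (cov ω) θ₀ (het ω) g * scoreNorm J (cov ω) θ₀ (het ω) g := by
      rw [Finset.sum_comm, Finset.mul_sum, Finset.mul_sum, ← Finset.sum_add_distrib]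
      refine Finset.sum_congr rfl fun g _ => ?_
      simp only [hf]
      rw [← Finset.mul_sum]
      ring
    rw [hexp]
    refine add_le_add (mul_le_mul_of_nonneg_left (Finset.sum_le_sum fun p hp => ?_)
      (by positivity)) (mul_le_mul_of_nonneg_left
        (sum_likelihood_mul_scoreNorm_le hJ hB h1.2 h2) hC0)
    exact sum_likelihood_mul_missInd_le hR' h hρ0 hJ hρ1 hfac h2 k₀ hp
  have hgi : ∀ p r, Integrable (fun ω => 1 - gapInd h Θ I ε κ θ₀ (cov ω) (het ω) p r) μ := by
    intro p r
    have h0 := (measurable_gapInd (θ := θ₀) h hΘ hI ε κ (fun i j => measurable_cov hw i j)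
      measurable_het p r).comp hz
    have h1 : Measurable fun ω => gapInd h Θ I ε κ θ₀ (cov ω) (het ω) p r := h0
    refine Integrable.of_bound (C := 1) (measurable_const.sub h1).aestronglyMeasurable
      (ae_of_all _ fun ω => ?_)
    have h2 := gapInd_nonneg (Θ := Θ) (I := I) (ε := ε) (κ := κ) (θ₀ := θ₀) (x := cov ω)
      (a₀ := het ω) h p r
    have h3 := gapInd_le_one (Θ := Θ) (I := I) (ε := ε) (κ := κ) (θ₀ := θ₀) (x := cov ω)
      (a₀ := het ω) h p r
    rw [Real.norm_eq_abs, abs_le]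
    constructor <;> linarith
  have hsi : ∀ p, Integrable (fun ω => 1 / (R' : ℝ) *
      ∑ r, (1 - gapInd h Θ I ε κ θ₀ (cov ω) (het ω) p r)) μ := fun p =>
    (integrable_finsetSum _ fun r _ => hgi p r).const_mul _
  have hpi : ∀ p, Integrable (fun ω => c' + 1 / (R' : ℝ) *
      ∑ r, (1 - gapInd h Θ I ε κ θ₀ (cov ω) (het ω) p r)) μ := fun p =>
    (integrable_const _).add (hsi p)
  have hbi : Integrable bound μ :=
    ((integrable_finsetSum _ fun p _ => hpi p).const_mul _).add (integrable_const _)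
  have hη0 : 0 ≤ η := measureReal_nonneg.trans hη
  have hc1 : ρ ^ m / 2 ≤ 1 := by
    have := pow_le_one₀ hρ0.le hρ1 (n := m)
    linarith
  have hc0 : 0 ≤ c' := pow_nonneg (sub_nonneg.2 (pow_le_one₀ (by positivity) hc1)) _
  have hp : ∀ p, ∫ ω, (c' + 1 / (R' : ℝ) *
      ∑ r, (1 - gapInd h Θ I ε κ θ₀ (cov ω) (het ω) p r)) ∂μ ≤ c' + 2 * η := by
    intro p
    rw [integral_add (integrable_const _) (hsi p), integral_const_mul,
      integral_finsetSum _ fun r _ => hgi p r, integral_const]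
    simp only [probReal_univ, one_smul]
    have hsum := Finset.sum_le_sum fun r (_ : r ∈ (Finset.univ : Finset (Fin (2 * R')))) =>
      integral_one_sub_gapInd_le hw hΘ hI hX hA₀ hindep hdist h hη p r
    rw [Finset.sum_const, Finset.card_univ, Fintype.card_fin, nsmul_eq_mul] at hsum
    refine add_le_add_right ((mul_le_mul_of_nonneg_left hsum (by positivity)).trans_eq ?_) _
    push_cast
    field_simp
  have hEbound : ∫ ω, bound ω ∂μ ≤ c' + 2 * η + C * ((m + B + 2) * (n * Real.sqrt n)) := by
    rw [hbound, integral_add ((integrable_finsetSum _ fun p _ => hpi p).const_mul _)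
      (integrable_const _), integral_const_mul, integral_finsetSum _ fun p _ => hpi p,
      integral_const]
    simp only [probReal_univ, one_smul]
    refine add_le_add_left ?_ _
    have hsum := Finset.sum_le_sum fun p (_ : p ∈ avoiding h J) => hp p
    rw [Finset.sum_const, nsmul_eq_mul] at hsum
    have hcard : ((avoiding h J).card : ℝ) ≤ (q : ℝ) ^ 2 := by
      have : (avoiding h J).card ≤ q ^ 2 := (Finset.card_le_univ _).trans_eq (by simp [sq])
      exact_mod_cast this
    calc _ ≤ 1 / (q : ℝ) ^ 2 * ((avoiding h J).card * (c' + 2 * η)) := by gcongr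
      _ ≤ 1 / (q : ℝ) ^ 2 * ((q : ℝ) ^ 2 * (c' + 2 * η)) := by gcongr
      _ = c' + 2 * η := by field_simp
  have hEf : ∫ ω, f ω (G ω) ∂μ ≤ c' + 2 * η + C * ((m + B + 2) * (n * Real.sqrt n)) := by
    rw [heq]
    exact (integral_mono_ae hint' hbi hle).trans hEbound
  -- a distant estimate forces `f` to be large
  have hfar : ∀ᵐ ω ∂μ, ω ∈ {ω | ε ≤ dist (θJML ω) θ₀} → ω ∈ {ω | 1 / 2 ≤ f ω (G ω)} := by
    filter_upwards [hdata, hJML] with ω h1 h2 h3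
    have h4 := gap_le_of_isJML h hκ.le hJ hk₀ h1.2 hB hD hΘD hID hθ₀ h1.1 h2 h3
    change 1 / 2 ≤ f ω (G ω)
    push_cast at h4
    have h5 : (0 : ℝ) < κ * q ^ 2 := by positivity
    have h6 := div_le_div_of_nonneg_right h4 h5.le
    have h7 : κ * ((q : ℝ) ^ 2 - 2 * R' * (N + 2) * m * q - ∑ p ∈ avoiding h J, miss ω (G ω) p) /
        (κ * q ^ 2) = 1 - 2 * R' * (N + 2) * m / q -
          1 / (q : ℝ) ^ 2 * ∑ p ∈ avoiding h J, miss ω (G ω) p := by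
      field_simp
    have h8 : 2 * R' * ((N : ℝ) + 2) ^ 2 * (2 * D * scoreNorm J (cov ω) θ₀ (het ω) (G ω) +
        4 * m * (m * D + B * D + 2 * D) * n) / (κ * q ^ 2) =
        C * scoreNorm J (cov ω) θ₀ (het ω) (G ω) + 2 * R' * (N + 2) ^ 2 *
          (4 * m * M * n) / (κ * q ^ 2) := by
      rw [hC, hM]
      field_simp
    have h9 := (h7.symm.trans_le h6).trans_eq h8
    simp only [hf]
    linarith
  have hmarkov := mul_meas_ge_le_integral_of_nonneg (ae_of_all μ fun ω => hf0 ω (G ω)) hint (1 / 2)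
  have hmono : μ.real {ω | ε ≤ dist (θJML ω) θ₀} ≤ μ.real {ω | 1 / 2 ≤ f ω (G ω)} :=
    ENNReal.toReal_mono (measure_ne_top _ _) (measure_mono_ae hfar)
  linarith

end Consistency

/-! ### Consistency -/

theorem proposition3
    {Ω : Type*} [MeasurableSpace Ω] (μ : Measure Ω) [IsProbabilityMeasure μ]
    {𝒳 : Type*} [MeasurableSpace 𝒳] {K : ℕ}
    -- known transformation giving the dyadic covariates, and parameter spaces
    (w : 𝒳 → 𝒳 → EuclideanSpace ℝ (Fin K)) (hw : Measurable (Function.uncurry w))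
    (𝔸 : Set (EuclideanSpace ℝ (Fin K))) (𝔹 : Set ℝ) (𝕀 : Set ℝ)
    (𝕏 : Set (EuclideanSpace ℝ (Fin K)))
    (β₀ : EuclideanSpace ℝ (Fin K)) (δ₀ : ℝ)
    -- players, reference sets for common links (of bounded size), and networks
    (X : ℕ → Ω → 𝒳) (A₀ : ℕ → Ω → ℝ) (hX : ∀ i, Measurable (X i)) (hA₀ : ∀ i, Measurable (A₀ i))
    (J : (n : ℕ) → Finset (Fin n)) (m : ℕ) (hJ : ∀ n, (J n).card ≤ m)
    (G : (n : ℕ) → Ω → SimpleGraph (Fin n))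
    (hG : ∀ n (g : SimpleGraph (Fin n)), MeasurableSet {ω | G n ω = g})
    -- likelihood: conditional law of the network given attributes and heterogeneity
    (hlik : ∀ n (g : SimpleGraph (Fin n)),
      μ[Set.indicator {ω | G n ω = g} (fun _ => (1 : ℝ)) | playerSigma X A₀ n] =ᵐ[μ]
        fun ω => likelihood (J n) (dyadCov w (fun i => X i ω) n) (β₀, δ₀)
          (fun i : Fin n => A₀ i ω) g)
    -- joint identification
    (hI : IsCompact 𝕀) (hA₀I : ∀ i, ∀ᵐ ω ∂μ, A₀ i ω ∈ 𝕀)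
    (hident : ∀ᵐ ω ∂μ, ∀ᶠ n : ℕ in atTop,
      IsJointlyIdentified (J n) (dyadCov w (fun i => X i ω) n) (𝔸 ×ˢ 𝔹) 𝕀 (β₀, δ₀)
        (fun i : Fin n => A₀ i ω))
    -- regularity
    (hAB : IsCompact (𝔸 ×ˢ 𝔹)) (hβ₀ : β₀ ∈ interior 𝔸) (hδ₀ : δ₀ ∈ interior 𝔹)
    (h𝕏 : IsCompact 𝕏) (hX𝕏 : ∀ i j, i ≠ j → ∀ᵐ ω ∂μ, w (X i ω) (X j ω) ∈ 𝕏)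
    -- random sampling
    (hindep : iIndepFun (fun i ω => (X i ω, A₀ i ω)) μ)
    (hident_distrib : ∀ i, IdentDistrib (fun ω => (X i ω, A₀ i ω)) (fun ω => (X 0 ω, A₀ 0 ω)) μ μ)
    -- joint maximum likelihood estimator
    (θJML : ℕ → Ω → EuclideanSpace ℝ (Fin K) × ℝ) (AJML : (n : ℕ) → Ω → Fin n → ℝ)
    (hθmeas : ∀ n, Measurable (θJML n))
    (hJML : ∀ n, ∀ᵐ ω ∂μ, IsJML (J n) (dyadCov w (fun i => X i ω) n) (G n ω) (𝔸 ×ˢ 𝔹) 𝕀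
      (θJML n ω) (AJML n ω)) :
    TendstoInMeasure μ θJML atTop (fun _ => (β₀, δ₀)) := by
  have hθ₀ : (β₀, δ₀) ∈ 𝔸 ×ˢ 𝔹 := ⟨interior_subset hβ₀, interior_subset hδ₀⟩
  rw [tendstoInMeasure_iff_dist]
  intro ε hε
  rcases Set.eq_empty_or_nonempty ((𝔸 ×ˢ 𝔹) ∩ {θ | ε ≤ dist θ (β₀, δ₀)}) with hempty | hne
  · -- no admissible parameter is at distance `ε` from the truth
    refine tendsto_const_nhds.congr fun n => Eq.symm (measure_eq_zero_iff_ae_notMem.2 ?_)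
    filter_upwards [hJML n] with ω hω hfar
    exact hempty.subset ⟨hω.1, hfar⟩
  rw [← ENNReal.tendsto_toReal_zero_iff fun n => measure_ne_top _ _]
  refine tendsto_order.2 ⟨fun a ha => Eventually.of_forall fun n =>
    ha.trans_le ENNReal.toReal_nonneg, fun τ hτ => ?_⟩
  obtain ⟨B, hB, hBX⟩ := h𝕏.isBounded.exists_pos_norm_le
  obtain ⟨D₁, hD₁, hDΘ⟩ := hAB.isBounded.exists_pos_norm_le
  obtain ⟨D₂, hD₂, hDI⟩ := hI.isBounded.exists_pos_norm_le
  set D : ℝ := max D₁ D₂ with hDdef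
  have hD : 0 ≤ D := hD₁.le.trans (le_max_left _ _)
  have hΘD : ∀ θ ∈ 𝔸 ×ˢ 𝔹, ‖θ.1‖ ≤ D ∧ |θ.2| ≤ D := fun θ hθ =>
    ⟨(norm_fst_le θ).trans ((hDΘ θ hθ).trans (le_max_left _ _)),
      (norm_snd_le θ).trans ((hDΘ θ hθ).trans (le_max_left _ _))⟩
  have hID : ∀ t ∈ 𝕀, |t| ≤ D := fun t ht => (hDI t ht).trans (le_max_right _ _)
  set M : ℝ := m * D + B * D + 2 * D with hM
  have hM0 : 0 ≤ M := by positivity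
  obtain ⟨N, κ, hκ, hgap⟩ := exists_measure_playerGap_lt_le hw hX hA₀ hI hA₀I hident hAB hθ₀.2 hε
    hne (η := τ / 16) (by positivity)
  -- the number `R'` of blocks makes it unlikely that all blocks of a progression miss the pattern
  obtain ⟨R₀, hR₀⟩ := exists_pow_lt_of_lt_one (show (0 : ℝ) < τ / 16 by positivity)
    (show 1 - ((1 / (1 + Real.exp M)) ^ m / 2) ^ ((N + 2) * m) < 1 by
      rw [sub_lt_self_iff]; positivity)
  have hbase : 0 ≤ 1 - ((1 / (1 + Real.exp M)) ^ m / 2) ^ ((N + 2) * m) := by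
    have h1 : 1 / (1 + Real.exp M) ≤ 1 := by
      rw [div_le_one (by positivity)]
      linarith [Real.exp_pos M]
    have h2 := pow_le_one₀ (n := m) (show 0 ≤ 1 / (1 + Real.exp M) by positivity) h1
    exact sub_nonneg.2 (pow_le_one₀ (by positivity) (by linarith))
  set R' : ℕ := R₀ + 1 with hR'
  have hRpow : (1 - ((1 / (1 + Real.exp M)) ^ m / 2) ^ ((N + 2) * m)) ^ R' ≤ τ / 16 :=
    (pow_le_pow_of_le_one hbase (sub_le_self _ (by positivity)) (Nat.le_succ R₀)).trans hR₀.le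
  have hR'0 : 0 < R' := Nat.succ_pos _
  set L : ℕ := 2 * R' * (N + 2) with hL
  have hL0 : 0 < L := by positivity
  have hq : Tendsto (fun n : ℕ => n / L) atTop atTop := Nat.tendsto_div_const_atTop hL0.ne'
  set C₁ : ℝ := 2 * R' * (N + 2) * m + 2 * R' * (N + 2) ^ 2 * (4 * m * M * (2 * L)) / κ with hC₁
  set C₂ : ℝ := 2 * R' * (N + 2) ^ 2 * (2 * D) / κ * ((m + B + 2) * (2 * L * Real.sqrt (2 * L)))
    with hC₂
  have hlim₁ : ∀ᶠ q : ℕ in atTop, C₁ / q ≤ 1 / 2 :=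
    (tendsto_const_div_atTop_nhds_zero_nat C₁).eventually_le_const (by norm_num)
  have hlim₂ : ∀ᶠ q : ℕ in atTop, C₂ / Real.sqrt q ≤ τ / 16 :=
    (tendsto_const_nhds.div_atTop (Real.tendsto_sqrt_atTop.comp
      tendsto_natCast_atTop_atTop)).eventually_le_const (by positivity)
  have hJne : ∀ᶠ n in atTop, (J n).Nonempty := by
    obtain ⟨ω, h1, h2⟩ := (hident.and (ae_all_iff.2 hA₀I)).exists
    filter_upwards [h1] with n hn
    exact nonempty_of_isJointlyIdentified hθ₀.1 hδ₀ (fun i => h2 i) hn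
  filter_upwards [hq.eventually hlim₁, hq.eventually hlim₂, hq.eventually_ge_atTop 1, hJne]
    with n h1 h2 h3 ⟨k₀, hk₀⟩
  set q : ℕ := n / L with hqdef
  have hqn : L * q ≤ n := Nat.mul_div_le n L
  have hq0 : (0 : ℝ) < q := Nat.cast_pos.2 h3
  have hL' : (0 : ℝ) < L := Nat.cast_pos.2 hL0
  have hnq : (n : ℝ) ≤ 2 * L * q := by
    have : n ≤ 2 * L * q := by
      have h4 := Nat.lt_mul_div_succ n hL0
      have h5 : L * 1 ≤ L * q := Nat.mul_le_mul_left L h3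
      rw [← hqdef, mul_add] at h4
      nlinarith
    exact_mod_cast this
  have hsmall : 2 * R' * (N + 2) * m / q + 2 * R' * (N + 2) ^ 2 *
      (4 * m * (m * D + B * D + 2 * D) * n) / (κ * q ^ 2) ≤ 1 / 2 := by
    refine le_trans ?_ h1
    calc _ ≤ 2 * R' * (N + 2) * m / q + 2 * R' * (N + 2) ^ 2 *
          (4 * m * M * (2 * L * q)) / (κ * q ^ 2) := by gcongr
      _ = _ := by
          rw [hC₁]
          field_simp
  have hscore : 2 * R' * (N + 2) ^ 2 * (2 * D) / (κ * q ^ 2) *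
      ((m + B + 2) * (n * Real.sqrt n)) ≤ τ / 16 := by
    refine le_trans ?_ h2
    have hs : 0 < Real.sqrt q := Real.sqrt_pos.2 hq0
    have hsq : (q : ℝ) = Real.sqrt q * Real.sqrt q := (Real.mul_self_sqrt hq0.le).symm
    have hsqrt : Real.sqrt n ≤ Real.sqrt (2 * L) * Real.sqrt q := by
      rw [← Real.sqrt_mul (by positivity)]
      exact Real.sqrt_le_sqrt hnq
    calc _ ≤ 2 * R' * (N + 2) ^ 2 * (2 * D) / (κ * q ^ 2) *
          ((m + B + 2) * ((2 * L * q) * (Real.sqrt (2 * L) * Real.sqrt q))) := by gcongr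
      _ = C₂ * (Real.sqrt q / q) := by
          rw [hC₂]
          field_simp
      _ = C₂ / Real.sqrt q := by
          rw [div_eq_mul_inv C₂]
          congr 1
          nth_rewrite 2 [hsq]
          field_simp
  have key := measureReal_dist_jml_le hw hAB hI hθ₀ hX hA₀ hindep hident_distrib (hJ n) hk₀ (hG n)
    (hlik n) hA₀I hB.le hD (fun i j hij => (hX𝕏 i j hij).mono fun ω hω => hBX _ hω) hΘD hID
    (hJML n) hR'0 h3 hqn hκ hgap hsmall
  refine lt_of_le_of_lt key ?_
  linarith
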